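/- Let $f\in C([0,1])$ satisfy $f(0)=f(1)=0$, $f>0$ on $(0,1)$ (type A), and $|f(s)|\le ks$, $|f(s)|\le k(1-s)$ on $[0,1]$ for some $k>0$. Assume moreover (F): $f$ is locally Lipschitz continuous on $(0,1)$ and has a unique local maximum point $v_{\max}\in(0,1)$. Set $F(v)=\int_0^v f(s)\,ds$ and $\mathcal V_0=1/2$. For $\varepsilon>0$, call $c\in\mathbb R$ an admissible speed if the problem $$y'=c\,\frac{\sqrt{y(2\varepsilon+y)}}{\varepsilon+y}-f(v),\qquad y(0)=y(1)=0,\qquad y>0\ \text{on }(0,1),$$ has a solution $y=y(v)$ on $[0,1]$. Then the set of admissible speeds is an interval $[c^*_\varepsilon,+\infty)$; $c^*_\varepsilon$ is called the critical speed. The equation $$\varepsilon\left(\frac{v'}{\sqrt{1-(v')^2}}\right)'-c^*_\varepsilon v'+f(v)=0$$ has a unique nondecreasing $C^2$ solution $v_\varepsilon:\mathbb R\to[0,1]$ with $|v_\varepsilon'|<1$, $v_\varepsilon(-\infty)=0$, $v_\varepsilon(+\infty)=1$ and $v_\varepsilon(0)=\mathcal V_0$; it is called the critical profile. The equation $F(v)=vf(v)$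 has a largest solution $v_+$ in $[0,1]$, and $v_+\in(0,1)$. As $\varepsilon\to0^+$, one has $c^*_\varepsilon\to f(v_+)$. For $\underline z\in\mathbb R$ and $\underline v\in(0,1)$, let $$\mathcal V_L(z;\underline z,\underline v)=\begin{cases}0,& z<\underline z-\underline v,\\ z-\underline z+\underline v,& \underline z-\underline v\le z\le 1+\underline z-\underline v,\\ 1,& z>1+\underline z-\underline v,\end{cases}$$ and let $\mathcal V_I(\cdot;\underline z,\underline v):\mathbb R\to(0,1]$ be the unique solution of $f(v_+)\,v'=f(v)$, $v(\underline z)=\underline v$. Then, as $\varepsilon\to0^+$, $v_\varepsilon\to\bar v$ uniformly on $\mathbb R$, where: - if $v_+\ge\mathcal V_0$, then $\bar v(z)=\mathcal V_L(z;0,\mathcal V_0)$ for $z\le v_+-\mathcal V_0$ and $\bar v(z)=\mathcal V_I(z;v_+-\mathcal V_0,v_+)$ for $z>v_+-\mathcal V_0$; - if $v_+<\mathcal V_0$, then $\bar v(z)=\mathcal V_L(z;z_+,v_+)$ for $z\le z_+$ and $\bar v(z)=\mathcal V_I(z;0,\mathcal V_0)$ for $z>z_+$, where $z_+<0$ is the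 unique real number with $\mathcal V_I(z_+;0,\mathcal V_0)=v_+$. In both cases the gluing is $C^1$: $\bar v$ is of class $C^1$ in a neighbourhood of the gluing point (respectively $v_+-\mathcal V_0$ and $z_+$), and its derivative there equals $1$. -/

import Mathlib

open Set Filter Topology

noncomputable section

/-- Regularity, zeros and linear controls of the reaction term `f : [0, 1] → ℝ`.
Throughout, only the values of `f` on `[0, 1]` matter. -/
structure ConditionH (f : ℝ → ℝ) : Prop where
  continuousOn : ContinuousOn f (Icc 0 1)
  zero : f 0 = 0
  one : f 1 = 0
  linear_control : ∃ k : ℝ, 0 < k ∧ ∀ s ∈ Icc (0 : ℝ) 1, |f s| ≤ k * s ∧ |f s| ≤ k * (1 - s)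

/-- Type A (monostable) reaction terms. -/
def IsTypeA (f : ℝ → ℝ) : Prop :=
  ∀ s ∈ Ioo (0 : ℝ) 1, 0 < f s

/-- `f` is locally Lipschitz and has a unique (not necessarily strict) local maximum point,
which lies in `(0, 1)`. Local Lipschitz continuity is only required inside the interval; the
end points `0`, `1` cannot be local maximum points of a type A term on `[0, 1]`. -/
structure ConditionF (f : ℝ → ℝ) : Prop where
  locallyLipschitzOn : LocallyLipschitzOn (Ioo 0 1) f
  unique_localMax : ∃! m : ℝ, m ∈ Ioo (0 : ℝ) 1 ∧ IsLocalMax f m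

/-- The primitive `F(v) = ∫₀ᵛ f(s) ds`. -/
def primitive (f : ℝ → ℝ) (v : ℝ) : ℝ :=
  ∫ s in (0 : ℝ)..v, f s

/-- The nonlinearity `√(y (2ε + y)) / (ε + y)` of the first-order reduction. -/
def reductionR (ε y : ℝ) : ℝ :=
  √(y * (2 * ε + y)) / (ε + y)

/-- `c` is an admissible speed: the first-order two-point problem
`y' = c √(y (2ε + y)) / (ε + y) - f(v)`, `y(0) = y(1) = 0`, `y > 0` on `(0, 1)`,
has a solution. -/
def IsAdmissibleSpeed (f : ℝ → ℝ) (ε c : ℝ) : Prop :=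
  ∃ y : ℝ → ℝ, ContinuousOn y (Icc 0 1) ∧ y 0 = 0 ∧ y 1 = 0 ∧
    ∀ v ∈ Ioo (0 : ℝ) 1, 0 < y v ∧ HasDerivAt y (c * reductionR ε (y v) - f v) v

/-- `c` is the critical speed: the admissible speeds are exactly the interval `[c, +∞)`. -/
def IsCriticalSpeed (f : ℝ → ℝ) (ε c : ℝ) : Prop :=
  {c' : ℝ | IsAdmissibleSpeed f ε c'} = Ici c

/-- Monotone heteroclinics: classical nondecreasing solutions `v` on the whole line of
`ε (v' / √(1 - v'²))' - c v' + f(v) = 0` with `v(-∞) = 0` and `v(+∞) = 1`. -/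
structure IsHeteroclinic (f : ℝ → ℝ) (ε c : ℝ) (v : ℝ → ℝ) : Prop where
  contDiff : ContDiff ℝ 2 v
  abs_deriv_lt_one : ∀ z, |deriv v z| < 1
  equation : ∀ z,
    ε * deriv (fun x => deriv v x / √(1 - (deriv v x) ^ 2)) z - c * deriv v z + f (v z) = 0
  monotone : Monotone v
  tendsto_atBot : Tendsto v atBot (𝓝 0)
  tendsto_atTop : Tendsto v atTop (𝓝 1)

/-- The normalization value at `z = 0` for type A reaction terms. -/
def normV0 : ℝ := 1 / 2

/-- The normalized front profile at speed `c`. -/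
def IsNormalizedProfile (f : ℝ → ℝ) (ε c : ℝ) (v : ℝ → ℝ) : Prop :=
  IsHeteroclinic f ε c v ∧ v 0 = normV0

/-- The piecewise linear profile `𝒱_L(z; z₀, v₀)`. -/
def profileL (z₀ v₀ z : ℝ) : ℝ :=
  if z < z₀ - v₀ then 0 else if z ≤ 1 + z₀ - v₀ then z - z₀ + v₀ else 1

/-- `V` is a positive solution on `ℝ` of the inviscid problem `c V' = f(V)`, `V(z₀) = v₀`, with
values where `f` is given, that is, in `[0, 1]`. -/
structure IsInviscidSolution (f : ℝ → ℝ) (c z₀ v₀ : ℝ) (V : ℝ → ℝ) : Prop where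
  pos : ∀ z, 0 < V z
  le_one : ∀ z, V z ≤ 1
  differentiable : Differentiable ℝ V
  equation : ∀ z, c * deriv V z = f (V z)
  initial : V z₀ = v₀

/-- `V` is the profile `𝒱_I(·; z₀, v₀)`, the unique positive solution of the inviscid problem. -/
def IsProfileI (f : ℝ → ℝ) (c z₀ v₀ : ℝ) (V : ℝ → ℝ) : Prop :=
  IsInviscidSolution f c z₀ v₀ V ∧ ∀ W : ℝ → ℝ, IsInviscidSolution f c z₀ v₀ W → W = V

/-- The function equal to `g` on `(-∞, z₀]` and to `h` on `(z₀, +∞)`. -/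
def glue (z₀ : ℝ) (g h : ℝ → ℝ) (z : ℝ) : ℝ :=
  if z ≤ z₀ then g z else h z

/-- The profiles `v ε` converge to `vbar` uniformly on `ℝ` as `ε → 0⁺`, and `vbar` is of class
`C¹` around the point `z₀`, with slope `1` there. -/
def ConvergesToGluing (v : ℝ → ℝ → ℝ) (vbar : ℝ → ℝ) (z₀ : ℝ) : Prop :=
  TendstoUniformly v vbar (𝓝[>] (0 : ℝ)) ∧ ContDiffAt ℝ 1 vbar z₀ ∧ deriv vbar z₀ = 1

end

/-! Along a front `v` the quantity `y = ε (1 / √(1 - v'²) - 1)`, seen as a function of the value of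
`v`, turns the second-order equation into `y' = c R(y) - f`, where `R = reductionR ε` and `v' =
R(y(v))`. Since `R` is nondecreasing, solutions with `y(1) = 0` can be compared backwards from `1`,
and `c` is admissible exactly when such a solution vanishes at `0`.

Write `p` for `v_+`. As `R < 1`, `y + F - c v` is nonincreasing; with `F(p) = p f(p)` this forces `c
> f(p)`. Conversely `√(ε² + q²) - ε`, with `q` a slightly tilted `f(p) v - F`, is a supersolution
vanishing at `0`, so `f(p) < c* ≤ f(p) + √(4kε)` (`exists_isCriticalSpeed`).

The slopes then converge (`tendsto_reductionR`). Below `p` the gap `f(p) v - F(v) > 0` keeps `y`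
away from `0`, so `R(y) → 1`. Above `p` the solution is trapped just under the nullcline `c R(y) =
f`, so `R(y) → f(v) / f(p)`. Hence the times `∫ dv / R(y(v))` at which the profiles reach each level
converge, and so do the profiles, pointwise and then uniformly by monotonicity
(`convergesToGluing`). The limit solves `v' = limitSpeed(v)` where it is positive. This speed is
continuous and equals `1` at `p`, which is the `C¹` gluing. -/

/-! ### Positivity from linear differential inequalities. -/

/-- A function with `N' ≤ C N` that is positive somewhere was positive before. -/
lemma pos_of_hasDerivAt_le_mul {N N' : ℝ → ℝ} {C a z : ℝ} (hN : ∀ x, HasDerivAt N (N' x) x)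
    (hle : ∀ x, N' x ≤ C * N x) (ha : 0 < N a) (hz : z ≤ a) : 0 < N z := by
  have hd : ∀ x, HasDerivAt (fun x => N x * Real.exp (-C * x))
      ((N' x - C * N x) * Real.exp (-C * x)) x := fun x => by
    have h1 : HasDerivAt (fun x : ℝ => Real.exp (-C * x)) (Real.exp (-C * x) * (-C * 1)) x :=
      ((hasDerivAt_id x).const_mul (-C)).exp
    exact ((hN x).mul h1).congr_deriv (by ring)
  have hanti : Antitone (fun x => N x * Real.exp (-C * x)) :=
    antitone_of_deriv_nonpos (fun x => (hd x).differentiableAt) fun x => by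
      rw [(hd x).deriv]
      exact mul_nonpos_of_nonpos_of_nonneg (by linarith [hle x]) (Real.exp_pos _).le
  have h := hanti hz
  have h2 : 0 < N a * Real.exp (-C * a) := mul_pos ha (Real.exp_pos _)
  exact pos_of_mul_pos_left (h2.trans_le h) (Real.exp_pos _).le

/-- A function with `N' ≥ -C N` that is positive somewhere remains positive. -/
lemma pos_of_neg_mul_le_hasDerivAt {N N' : ℝ → ℝ} {C a z : ℝ} (hN : ∀ x, HasDerivAt N (N' x) x)
    (hle : ∀ x, -C * N x ≤ N' x) (ha : 0 < N a) (hz : a ≤ z) : 0 < N z := by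
  have h := pos_of_hasDerivAt_le_mul (N := fun x => N (-x)) (N' := fun x => -N' (-x)) (C := C)
    (a := -a) (z := -z) (fun x => by
      simpa [Function.comp_def] using HasDerivAt.scomp x (hN (-x)) (hasDerivAt_neg x))
    (fun x => by linarith [hle (-x)]) (by simpa using ha) (by linarith)
  simpa using h

/-! ### Autonomous equations with positive speed on `(0, 1)`, solved by inverting the time map. -/

/-- A speed on `(0, 1)` whose end points are reached in infinite time only. -/
structure IsSpeedField (G : ℝ → ℝ) : Prop where
  continuousOn : ContinuousOn G (Ioo 0 1)
  pos : ∀ s ∈ Ioo (0 : ℝ) 1, 0 < G s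
  bound : ∃ K : ℝ, 0 < K ∧ ∀ s ∈ Ioo (0 : ℝ) 1, G s ≤ K * s ∧ G s ≤ K * (1 - s)

/-- The time at which the solution of `v' = G(v)`, `v(0) = 1/2`, takes the value `s`. -/
noncomputable def timeMap (G : ℝ → ℝ) (s : ℝ) : ℝ :=
  ∫ r in (1 / 2 : ℝ)..s, (G r)⁻¹

lemma timeMap_half (G : ℝ → ℝ) : timeMap G (1 / 2) = 0 := by simp [timeMap]

lemma hasDerivAt_timeMap {G : ℝ → ℝ} (hc : ContinuousOn G (Ioo 0 1))
    (hp : ∀ s ∈ Ioo (0 : ℝ) 1, 0 < G s) {s : ℝ} (hs : s ∈ Ioo (0 : ℝ) 1) :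
    HasDerivAt (timeMap G) (G s)⁻¹ s := by
  have hcont : ContinuousOn (fun r => (G r)⁻¹) (Ioo 0 1) := hc.inv₀ fun r hr => (hp r hr).ne'
  have hsub : uIcc (1 / 2 : ℝ) s ⊆ Ioo 0 1 := by
    refine ordConnected_Ioo.uIcc_subset ⟨by norm_num, by norm_num⟩ hs
  exact intervalIntegral.integral_hasDerivAt_right ((hcont.mono hsub).intervalIntegrable)
    (hcont.stronglyMeasurableAtFilter isOpen_Ioo s hs) (hcont.continuousAt (isOpen_Ioo.mem_nhds hs))

lemma strictMonoOn_timeMap {G : ℝ → ℝ} (hc : ContinuousOn G (Ioo 0 1))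
    (hp : ∀ s ∈ Ioo (0 : ℝ) 1, 0 < G s) : StrictMonoOn (timeMap G) (Ioo 0 1) := by
  refine strictMonoOn_of_deriv_pos (convex_Ioo 0 1)
    (fun s hs => (hasDerivAt_timeMap hc hp hs).continuousAt.continuousWithinAt) fun s hs => ?_
  rw [interior_Ioo] at hs
  rw [(hasDerivAt_timeMap hc hp hs).deriv]
  exact inv_pos.2 (hp s hs)

/-- Along a solution of `v' = G(v)`, the time map is the time up to a constant. -/
lemma timeMap_sub_eq {G W : ℝ → ℝ} (hc : ContinuousOn G (Ioo 0 1))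
    (hp : ∀ s ∈ Ioo (0 : ℝ) 1, 0 < G s) {S : Set ℝ} (hS : IsOpen S) (hSc : Convex ℝ S)
    (hW : ∀ z ∈ S, W z ∈ Ioo (0 : ℝ) 1) (hd : ∀ z ∈ S, HasDerivAt W (G (W z)) z)
    {z z₀ : ℝ} (hz : z ∈ S) (hz₀ : z₀ ∈ S) :
    timeMap G (W z) - timeMap G (W z₀) = z - z₀ := by
  have hd' : ∀ x ∈ S, HasDerivAt (fun x => timeMap G (W x) - x) 0 x := fun x hx => by
    have h := ((hasDerivAt_timeMap hc hp (hW x hx)).comp x (hd x hx)).sub (hasDerivAt_id x)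
    rw [inv_mul_cancel₀ (hp _ (hW x hx)).ne', sub_self] at h
    exact h
  have := hS.is_const_of_deriv_eq_zero hSc.isPreconnected
    (fun x hx => (hd' x hx).differentiableAt.differentiableWithinAt)
    (fun x hx => (hd' x hx).deriv) hz hz₀
  linarith

namespace IsSpeedField

variable {G : ℝ → ℝ}

/-- The linear bounds on `G` make `∫ 1 / G` diverge at least logarithmically at both ends: `K *
timeMap G s + log (1 - s)` and `K * timeMap G s - log s` are nondecreasing. The intermediate value
theorem does the rest. -/
lemma exists_timeMap_eq (h : IsSpeedField G) (t : ℝ) : ∃ s ∈ Ioo (0 : ℝ) 1, timeMap G s = t := by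
  obtain ⟨K, hK, hb⟩ := h.bound
  have half : (1 / 2 : ℝ) ∈ Ioo (0 : ℝ) 1 := by norm_num
  have hcont : ContinuousOn (timeMap G) (Ioo 0 1) := fun s hs =>
    (hasDerivAt_timeMap h.continuousOn h.pos hs).continuousAt.continuousWithinAt
  have hup : ∀ t : ℝ, 0 ≤ t → ∃ s ∈ Ioo (0 : ℝ) 1, t ≤ timeMap G s := fun t ht => by
    have hd : ∀ s ∈ Ioo (0 : ℝ) 1,
        HasDerivAt (fun s => K * timeMap G s + Real.log (1 - s))
          (K * (G s)⁻¹ + (-1) / (1 - s)) s := fun s hs =>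
      ((hasDerivAt_timeMap h.continuousOn h.pos hs).const_mul K).add
        (((hasDerivAt_id s).const_sub 1).log (by simpa using (sub_pos.2 hs.2).ne'))
    have hm : MonotoneOn (fun s => K * timeMap G s + Real.log (1 - s)) (Ioo 0 1) := by
      refine monotoneOn_of_deriv_nonneg (convex_Ioo 0 1)
        (fun s hs => (hd s hs).continuousAt.continuousWithinAt) ?_ ?_
      · rw [interior_Ioo]
        exact fun s hs => (hd s hs).differentiableAt.differentiableWithinAt
      · rw [interior_Ioo]
        intro s hs
        rw [(hd s hs).deriv]
        have h1 := (hb s hs).2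
        have h2 := h.pos s hs
        have h3 : 0 < 1 - s := sub_pos.2 hs.2
        have : K * (G s)⁻¹ + -1 / (1 - s) = (K * (1 - s) - G s) / (G s * (1 - s)) := by
          field_simp
          ring
        rw [this]
        exact div_nonneg (by linarith) (by positivity)
    have he : Real.exp (-(K * t)) ≤ 1 := Real.exp_le_one_iff.2 (by nlinarith)
    have he0 := Real.exp_pos (-(K * t))
    -- At this point `log (1 - s)` is exactly `K * t` below its value at `1 / 2`.
    have hs : 1 - Real.exp (-(K * t)) / 2 ∈ Ioo (0 : ℝ) 1 := ⟨by linarith, by linarith⟩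
    refine ⟨_, hs, ?_⟩
    have h1 := hm half hs (by linarith)
    simp only [timeMap_half] at h1
    rw [show (1 - (1 - Real.exp (-(K * t)) / 2)) = Real.exp (-(K * t)) * (1 - 1 / 2) by ring,
      Real.log_mul he0.ne' (by norm_num), Real.log_exp] at h1
    nlinarith
  have hdn : ∀ t : ℝ, t ≤ 0 → ∃ s ∈ Ioo (0 : ℝ) 1, timeMap G s ≤ t := fun t ht => by
    have hd : ∀ s ∈ Ioo (0 : ℝ) 1,
        HasDerivAt (fun s => K * timeMap G s - Real.log s) (K * (G s)⁻¹ - s⁻¹) s := fun s hs =>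
      ((hasDerivAt_timeMap h.continuousOn h.pos hs).const_mul K).sub (Real.hasDerivAt_log hs.1.ne')
    have hm : MonotoneOn (fun s => K * timeMap G s - Real.log s) (Ioo 0 1) := by
      refine monotoneOn_of_deriv_nonneg (convex_Ioo 0 1)
        (fun s hs => (hd s hs).continuousAt.continuousWithinAt) ?_ ?_
      · rw [interior_Ioo]
        exact fun s hs => (hd s hs).differentiableAt.differentiableWithinAt
      · rw [interior_Ioo]
        intro s hs
        rw [(hd s hs).deriv]
        have h1 := (hb s hs).1
        have h2 := h.pos s hs
        have h3 := hs.1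
        have : K * (G s)⁻¹ - s⁻¹ = (K * s - G s) / (G s * s) := by
          field_simp
        rw [this]
        exact div_nonneg (by linarith) (by positivity)
    have he : Real.exp (K * t) ≤ 1 := Real.exp_le_one_iff.2 (by nlinarith)
    have he0 := Real.exp_pos (K * t)
    have hs : Real.exp (K * t) * (1 / 2) ∈ Ioo (0 : ℝ) 1 := ⟨by linarith, by linarith⟩
    refine ⟨_, hs, ?_⟩
    have h1 := hm hs half (by linarith)
    simp only [timeMap_half] at h1
    rw [Real.log_mul he0.ne' (by norm_num), Real.log_exp] at h1
    nlinarith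
  rcases le_total 0 t with ht | ht
  · obtain ⟨s, hs, hst⟩ := hup t ht
    exact (isPreconnected_Ioo.intermediate_value half hs hcont)
      ⟨by rw [timeMap_half]; exact ht, hst⟩
  · obtain ⟨s, hs, hst⟩ := hdn t ht
    exact (isPreconnected_Ioo.intermediate_value hs half hcont)
      ⟨hst, by rw [timeMap_half]; exact ht⟩

/-- The solution of `v' = G(v)`, `v(0) = 1/2`. -/
noncomputable def flow (h : IsSpeedField G) (z : ℝ) : ℝ := (h.exists_timeMap_eq z).choose

lemma flow_mem (h : IsSpeedField G) (z : ℝ) : h.flow z ∈ Ioo (0 : ℝ) 1 :=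
  (h.exists_timeMap_eq z).choose_spec.1

lemma timeMap_flow (h : IsSpeedField G) (z : ℝ) : timeMap G (h.flow z) = z :=
  (h.exists_timeMap_eq z).choose_spec.2

lemma flow_timeMap (h : IsSpeedField G) {s : ℝ} (hs : s ∈ Ioo (0 : ℝ) 1) :
    h.flow (timeMap G s) = s :=
  (strictMonoOn_timeMap h.continuousOn h.pos).injOn (h.flow_mem _) hs (h.timeMap_flow _)

lemma strictMono_flow (h : IsSpeedField G) : StrictMono h.flow := fun a b hab =>
  ((strictMonoOn_timeMap h.continuousOn h.pos).lt_iff_lt (h.flow_mem a) (h.flow_mem b)).1 (by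
    rwa [h.timeMap_flow, h.timeMap_flow])

lemma lt_flow_iff (h : IsSpeedField G) {s z : ℝ} (hs : s ∈ Ioo (0 : ℝ) 1) :
    s < h.flow z ↔ timeMap G s < z := by
  rw [← h.strictMono_flow.lt_iff_lt (a := timeMap G s), h.flow_timeMap hs]

lemma flow_lt_iff (h : IsSpeedField G) {s z : ℝ} (hs : s ∈ Ioo (0 : ℝ) 1) :
    h.flow z < s ↔ z < timeMap G s := by
  rw [← h.strictMono_flow.lt_iff_lt (b := timeMap G s), h.flow_timeMap hs]

lemma continuous_flow (h : IsSpeedField G) : Continuous h.flow := by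
  refine continuous_iff_continuousAt.2 fun z => tendsto_order.2 ⟨fun s hs => ?_, fun s hs => ?_⟩
  · rcases le_or_gt s 0 with h0 | h0
    · exact Eventually.of_forall fun y => h0.trans_lt (h.flow_mem y).1
    have hs' : s ∈ Ioo (0 : ℝ) 1 := ⟨h0, hs.trans (h.flow_mem z).2⟩
    filter_upwards [Ioi_mem_nhds ((h.lt_flow_iff hs').1 hs)] with y hy
    exact (h.lt_flow_iff hs').2 hy
  · rcases le_or_gt 1 s with h0 | h0
    · exact Eventually.of_forall fun y => (h.flow_mem y).2.trans_le h0
    have hs' : s ∈ Ioo (0 : ℝ) 1 := ⟨(h.flow_mem z).1.trans hs, h0⟩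
    filter_upwards [Iio_mem_nhds ((h.flow_lt_iff hs').1 hs)] with y hy
    exact (h.flow_lt_iff hs').2 hy

lemma hasDerivAt_flow (h : IsSpeedField G) (z : ℝ) : HasDerivAt h.flow (G (h.flow z)) z := by
  have := HasDerivAt.of_local_left_inverse h.continuous_flow.continuousAt
    (hasDerivAt_timeMap h.continuousOn h.pos (h.flow_mem z))
    (inv_ne_zero (h.pos _ (h.flow_mem z)).ne') (Eventually.of_forall h.timeMap_flow)
  rwa [inv_inv] at this

lemma tendsto_flow_atBot (h : IsSpeedField G) : Tendsto h.flow atBot (𝓝 0) := by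
  refine tendsto_order.2 ⟨fun s hs => Eventually.of_forall fun y => hs.trans (h.flow_mem y).1,
    fun s hs => ?_⟩
  rcases le_or_gt 1 s with h0 | h0
  · exact Eventually.of_forall fun y => (h.flow_mem y).2.trans_le h0
  filter_upwards [Iio_mem_atBot (timeMap G s)] with y hy
  exact (h.flow_lt_iff ⟨hs, h0⟩).2 hy

lemma tendsto_flow_atTop (h : IsSpeedField G) : Tendsto h.flow atTop (𝓝 1) := by
  refine tendsto_order.2 ⟨fun s hs => ?_,
    fun s hs => Eventually.of_forall fun y => (h.flow_mem y).2.trans hs⟩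
  rcases le_or_gt s 0 with h0 | h0
  · exact Eventually.of_forall fun y => h0.trans_lt (h.flow_mem y).1
  filter_upwards [Ioi_mem_atTop (timeMap G s)] with y hy
  exact (h.lt_flow_iff ⟨h0, hs⟩).2 hy

lemma flow_zero (h : IsSpeedField G) : h.flow 0 = 1 / 2 := by
  simpa only [timeMap_half] using h.flow_timeMap (s := 1 / 2) (by norm_num)

/-- Solutions with values in `(0, 1)` are translates of `flow`. -/
lemma eq_flow (h : IsSpeedField G) {W : ℝ → ℝ} (hW : ∀ z, W z ∈ Ioo (0 : ℝ) 1)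
    (hd : ∀ z, HasDerivAt W (G (W z)) z) (z₀ z : ℝ) :
    W z = h.flow (z - z₀ + timeMap G (W z₀)) := by
  have := timeMap_sub_eq h.continuousOn h.pos isOpen_univ convex_univ (fun z _ => hW z)
    (fun z _ => hd z) (mem_univ z) (mem_univ z₀)
  rw [← h.flow_timeMap (hW z)]
  congr 1
  linarith

end IsSpeedField

/-! ### Monotonicity and moduli of continuity of the reduced nonlinearity. -/

section reductionR

variable {ε : ℝ}

lemma reductionR_zero (ε : ℝ) : reductionR ε 0 = 0 := by simp [reductionR]

lemma reductionR_eq_sqrt (hε : 0 < ε) {y : ℝ} (hy : 0 ≤ y) :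
    reductionR ε y = √(1 - (ε / (ε + y)) ^ 2) := by
  have h : 0 < ε + y := by linarith
  rw [reductionR, show 1 - (ε / (ε + y)) ^ 2 = y * (2 * ε + y) / (ε + y) ^ 2 by field_simp; ring,
    Real.sqrt_div (by positivity), Real.sqrt_sq h.le]

lemma reductionR_nonneg (hε : 0 < ε) {y : ℝ} (hy : 0 ≤ y) : 0 ≤ reductionR ε y := by
  rw [reductionR_eq_sqrt hε hy]; exact Real.sqrt_nonneg _

lemma reductionR_pos (hε : 0 < ε) {y : ℝ} (hy : 0 < y) : 0 < reductionR ε y :=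
  div_pos (Real.sqrt_pos.2 (by positivity)) (by positivity)

lemma reductionR_sq (hε : 0 < ε) {y : ℝ} (hy : 0 ≤ y) :
    reductionR ε y ^ 2 = 1 - (ε / (ε + y)) ^ 2 := by
  rw [reductionR_eq_sqrt hε hy, Real.sq_sqrt]
  have : ε / (ε + y) ≤ 1 := (div_le_one (by linarith)).2 (by linarith)
  have : 0 ≤ ε / (ε + y) := div_nonneg hε.le (by linarith)
  nlinarith

lemma reductionR_lt_one (hε : 0 < ε) {y : ℝ} (hy : 0 ≤ y) : reductionR ε y < 1 := by
  have h := reductionR_sq hε hy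
  have : 0 < ε / (ε + y) := div_pos hε (by linarith)
  nlinarith [reductionR_nonneg hε hy]

lemma reductionR_mono (hε : 0 < ε) {x y : ℝ} (hx : 0 ≤ x) (hxy : x ≤ y) :
    reductionR ε x ≤ reductionR ε y := by
  rw [reductionR_eq_sqrt hε hx, reductionR_eq_sqrt hε (hx.trans hxy)]
  have : 0 < ε + x := by linarith
  have : 0 < ε + y := by linarith
  gcongr

/-- `R` behaves like `√(2y/ε)` near `0`, so only its square is Lipschitz there. This follows from
`R² = 1 - t²`, where `t = ε / (ε + y)` lies in `(0, 1]` and is `1/ε`-Lipschitz. It yields Hölder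
continuity of exponent `1/2` up to `0` and Lipschitz continuity away from `0`. -/
lemma reductionR_sq_sub_le (hε : 0 < ε) {x y : ℝ} (hx : 0 ≤ x) (hxy : x ≤ y) :
    reductionR ε y ^ 2 - reductionR ε x ^ 2 ≤ 2 / ε * (y - x) := by
  have hy := hx.trans hxy
  rw [reductionR_sq hε hx, reductionR_sq hε hy]
  have hx' : 0 < ε + x := by linarith
  have hy' : 0 < ε + y := by linarith
  have h1 : ε / (ε + x) ≤ 1 := (div_le_one hx').2 (by linarith)
  have h2 : ε / (ε + y) ≤ 1 := (div_le_one hy').2 (by linarith)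
  have h3 : ε / (ε + x) - ε / (ε + y) ≤ 1 / ε * (y - x) := by
    have : 1 / ε * (y - x) - (ε / (ε + x) - ε / (ε + y)) =
        (y - x) * (ε * (x + y) + x * y) / (ε * (ε + x) * (ε + y)) := by
      field_simp; ring
    have h4 : 0 ≤ (y - x) * (ε * (x + y) + x * y) / (ε * (ε + x) * (ε + y)) :=
      div_nonneg (mul_nonneg (by linarith) (by positivity)) (by positivity)
    linarith
  have h5 : 0 ≤ ε / (ε + x) - ε / (ε + y) := by
    have : ε / (ε + y) ≤ ε / (ε + x) := by gcongr
    linarith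
  have h6 : 0 < ε / (ε + y) := by positivity
  have : 2 / ε * (y - x) = 2 * (1 / ε * (y - x)) := by ring
  nlinarith

lemma reductionR_sub_le_sqrt (hε : 0 < ε) {x y : ℝ} (hx : 0 ≤ x) (hxy : x ≤ y) :
    reductionR ε y - reductionR ε x ≤ √(2 / ε * (y - x)) := by
  have h := reductionR_sq_sub_le hε hx hxy
  have h0 := reductionR_nonneg hε hx
  have hm := reductionR_mono hε hx hxy
  refine Real.le_sqrt_of_sq_le ?_
  nlinarith

lemma reductionR_le_sqrt (hε : 0 < ε) {y : ℝ} (hy : 0 ≤ y) : reductionR ε y ≤ √(2 / ε * y) := by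
  simpa [reductionR_zero] using reductionR_sub_le_sqrt hε le_rfl hy

lemma abs_reductionR_sub_le (hε : 0 < ε) {x y : ℝ} (hx : 0 ≤ x) (hy : 0 ≤ y) :
    |reductionR ε x - reductionR ε y| ≤ √(2 / ε * |x - y|) := by
  rcases le_total x y with h | h
  · have := reductionR_mono hε hx h
    rw [abs_of_nonpos (by linarith), abs_of_nonpos (by linarith)]
    simpa using reductionR_sub_le_sqrt hε hx h
  · have := reductionR_mono hε hy h
    rw [abs_of_nonneg (by linarith), abs_of_nonneg (by linarith)]
    simpa using reductionR_sub_le_sqrt hε hy h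

lemma abs_reductionR_sub_le_mul (hε : 0 < ε) {d x y : ℝ} (hd : 0 < d) (hx : d ≤ x) (hy : d ≤ y) :
    |reductionR ε x - reductionR ε y| ≤ 2 / ε / reductionR ε d * |x - y| := by
  have hR := reductionR_pos hε hd
  wlog h : x ≤ y generalizing x y
  · rw [abs_sub_comm, abs_sub_comm x]; exact this hy hx (le_of_not_ge h)
  have hx0 : 0 ≤ x := hd.le.trans hx
  have := reductionR_mono hε hx0 h
  have h1 := reductionR_mono hε hd.le hx
  have h2 := reductionR_sq_sub_le hε hx0 h
  rw [abs_of_nonpos (by linarith), abs_of_nonpos (by linarith), div_mul_eq_mul_div, le_div_iff₀ hR]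
  nlinarith

lemma continuousOn_reductionR (hε : 0 < ε) : ContinuousOn (reductionR ε) (Ici 0) := by
  unfold reductionR
  refine ContinuousOn.div (by fun_prop) (by fun_prop) fun y hy => ?_
  have : (0 : ℝ) ≤ y := hy
  positivity

/-- The substitution `y = √(ε² + h²) - ε` turns `y (2ε + y)` into `h²`. It serves both for the
supersolution behind the critical speed and for recovering `y` from the flux of a heteroclinic. -/
lemma reductionR_sqrt_sub (hε : 0 < ε) {h : ℝ} (hh : 0 ≤ h) :
    reductionR ε (√(ε ^ 2 + h ^ 2) - ε) = h / √(ε ^ 2 + h ^ 2) := by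
  have hs : √(ε ^ 2 + h ^ 2) ^ 2 = ε ^ 2 + h ^ 2 := Real.sq_sqrt (by positivity)
  rw [reductionR, show (√(ε ^ 2 + h ^ 2) - ε) * (2 * ε + (√(ε ^ 2 + h ^ 2) - ε)) = h ^ 2 by
    linear_combination hs, Real.sqrt_sq hh]
  congr 1
  ring

/-- Explicit lower bound, close to `1` for `y` much larger than `ε`. -/
lemma one_sub_div_le_reductionR (hε : 0 < ε) {y : ℝ} (hy : 0 ≤ y) :
    1 - ε / (ε + y) ≤ reductionR ε y := by
  have h := reductionR_sq hε hy
  have h0 := reductionR_nonneg hε hy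
  have h1 : ε / (ε + y) ≤ 1 := (div_le_one (by linarith)).2 (by linarith)
  have h2 : 0 ≤ ε / (ε + y) := div_nonneg hε.le (by linarith)
  nlinarith

end reductionR

/-! ### Backward comparison and the terminal value problem. -/

/-- A function which is nondecreasing where positive and ends nonpositive is nonpositive. -/
lemma nonpos_of_hasDerivAt_nonneg {w : ℝ → ℝ} {a b : ℝ} (hw : ContinuousOn w (Icc a b))
    (hd : ∀ x ∈ Ioo a b, 0 < w x → ∃ d, 0 ≤ d ∧ HasDerivAt w d x) (hb : w b ≤ 0) :
    ∀ x ∈ Icc a b, w x ≤ 0 := by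
  intro x hx
  by_contra! hpos
  have hsub : Icc x b ⊆ Icc a b := Icc_subset_Icc_left hx.1
  have hc : IsCompact (Icc x b ∩ w ⁻¹' Iic 0) :=
    ((hw.mono hsub).preimage_isClosed_of_isClosed isClosed_Icc isClosed_Iic
      |> isCompact_Icc.of_isClosed_subset) inter_subset_left
  -- `t` is the first point after `x` where `w ≤ 0`; on `[x, t]` the function is nondecreasing and
  -- starts positive, which is absurd.
  obtain ⟨t, ⟨⟨hxt, htb⟩, ht0⟩, hmin⟩ :=
    hc.exists_isLeast ⟨b, right_mem_Icc.2 hx.2, hb⟩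
  have hlt : ∀ s ∈ Ioo x t, 0 < w s := fun s hs => by
    by_contra! h
    exact (hmin ⟨⟨hs.1.le, hs.2.le.trans htb⟩, h⟩).not_gt hs.2
  have hm : MonotoneOn w (Icc x t) := by
    refine monotoneOn_of_deriv_nonneg (convex_Icc x t)
      (hw.mono ((Icc_subset_Icc_right htb).trans hsub)) ?_ ?_
    all_goals
      rw [interior_Icc]
      intro s hs
      obtain ⟨d, hd0, hd⟩ := hd s ⟨hx.1.trans_lt hs.1, hs.2.trans_le htb⟩ (hlt s hs)
    · exact hd.differentiableAt.differentiableWithinAt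
    · rwa [hd.deriv]
  have := hm (left_mem_Icc.2 hxt) (right_mem_Icc.2 hxt) hxt
  have h0 : w t ≤ 0 := ht0
  linarith

/-- Terminal value problem with a bounded Lipschitz nonlinearity. -/
lemma exists_terminal_of_lipschitz {f Φ : ℝ → ℝ} {K : NNReal} (c : ℝ)
    (hf : ContinuousOn f (Icc 0 1)) (hΦ : LipschitzWith K Φ) (hb : ∀ y, |Φ y| ≤ 1) :
    ∃ y : ℝ → ℝ, ContinuousOn y (Icc 0 1) ∧ y 1 = 0 ∧
      ∀ v ∈ Ioo (0 : ℝ) 1, HasDerivAt y (c * Φ (y v) - f v) v := by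
  obtain ⟨k, hk⟩ := isCompact_Icc.exists_bound_of_continuousOn hf
  have hk0 : 0 ≤ k := (norm_nonneg _).trans (hk 0 (by simp))
  -- The right-hand side is bounded by `|c| + k`, so over time at most `1` a solution starting from
  -- `0` stays in the ball of that radius: existence on all of `[0, 1]` follows.
  have hPL : IsPicardLindelof (fun v y => c * Φ y - f v) (tmin := 0) (tmax := 1)
      ⟨1, by simp⟩ 0 (Real.toNNReal (|c| + k)) 0 (Real.toNNReal (|c| + k))
      (Real.toNNReal |c| * K) := by
    refine ⟨fun t ht => ?_, fun x _ => ?_, fun t ht x _ => ?_, ?_⟩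
    · refine (LipschitzWith.of_dist_le_mul fun x y => ?_).lipschitzOnWith
      have := hΦ.dist_le_mul x y
      rw [Real.dist_eq] at this ⊢
      rw [show c * Φ x - f t - (c * Φ y - f t) = c * (Φ x - Φ y) by ring, abs_mul]
      simp only [NNReal.coe_mul, Real.coe_toNNReal _ (abs_nonneg c), mul_assoc]
      gcongr
    · exact continuousOn_const.sub hf
    · rw [Real.coe_toNNReal _ (by positivity)]
      refine (norm_sub_le _ _).trans (add_le_add ?_ (hk t ht))
      rw [norm_mul]
      exact mul_le_of_le_one_right (norm_nonneg _) (hb x)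
    · simp
  obtain ⟨y, h1, hy⟩ := hPL.exists_eq_forall_mem_Icc_hasDerivWithinAt₀
  exact ⟨y, fun v hv => (hy v hv).continuousWithinAt, h1, fun v hv =>
    (hy v (Ioo_subset_Icc_self hv)).hasDerivAt (Icc_mem_nhds hv.1 hv.2)⟩

/-- Terminal values depend continuously on the (nondecreasing) nonlinearity. -/
lemma sub_le_of_terminal {f Φ Φ₁ Φ₂ y₁ y₂ : ℝ → ℝ} {c δ₁ δ₂ : ℝ} (hc : 0 ≤ c) (hΦ : Monotone Φ)
    (h₁ : ∀ y, |Φ₁ y - Φ y| ≤ δ₁) (h₂ : ∀ y, |Φ₂ y - Φ y| ≤ δ₂)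
    (hy₁ : ContinuousOn y₁ (Icc 0 1)) (hy₂ : ContinuousOn y₂ (Icc 0 1)) (h1 : y₁ 1 = y₂ 1)
    (hd₁ : ∀ v ∈ Ioo (0 : ℝ) 1, HasDerivAt y₁ (c * Φ₁ (y₁ v) - f v) v)
    (hd₂ : ∀ v ∈ Ioo (0 : ℝ) 1, HasDerivAt y₂ (c * Φ₂ (y₂ v) - f v) v) :
    ∀ v ∈ Icc (0 : ℝ) 1, y₁ v - y₂ v ≤ c * (δ₁ + δ₂) := by
  have hδ₁ : 0 ≤ δ₁ := (abs_nonneg _).trans (h₁ 0)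
  have hδ₂ : 0 ≤ δ₂ := (abs_nonneg _).trans (h₂ 0)
  -- The linear term absorbs the errors `δ₁ + δ₂`: where the difference exceeds it, `y₂ ≤ y₁`, and
  -- monotonicity of `Φ` gives the sign of the derivative.
  have key := nonpos_of_hasDerivAt_nonneg (w := fun v => y₁ v - y₂ v - c * (δ₁ + δ₂) * (1 - v))
    (a := 0) (b := 1) (by fun_prop) (fun v hv hpos => ?_) (by simp [h1])
  · intro v hv
    have := key v hv
    have h3 : c * (δ₁ + δ₂) * (1 - v) ≤ c * (δ₁ + δ₂) * 1 :=
      mul_le_mul_of_nonneg_left (by linarith [hv.1]) (by positivity)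
    linarith
  · refine ⟨_, ?_, ((hd₁ v hv).sub (hd₂ v hv)).sub
      (((hasDerivAt_id v).const_sub 1).const_mul (c * (δ₁ + δ₂)))⟩
    have h3 : 0 ≤ c * (δ₁ + δ₂) * (1 - v) :=
      mul_nonneg (by positivity) (by linarith [hv.2])
    have h4 := hΦ (show y₂ v ≤ y₁ v by linarith)
    have h5 := abs_le.1 (h₁ (y₁ v))
    have h6 := abs_le.1 (h₂ (y₂ v))
    have : 0 ≤ c * (Φ₁ (y₁ v) - Φ₂ (y₂ v) + (δ₁ + δ₂)) := mul_nonneg hc (by linarith)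
    linarith

/-- The nonlinearity is not Lipschitz at `0`, so its argument is shifted by `d n > 0`, and `d n →
0`. Monotonicity makes the shifted solutions uniformly Cauchy; by the Hölder bound their derivatives
converge uniformly as well. -/
lemma exists_terminal {f : ℝ → ℝ} {ε c : ℝ} (hε : 0 < ε) (hc : 0 ≤ c)
    (hf : ContinuousOn f (Icc 0 1)) :
    ∃ y : ℝ → ℝ, ContinuousOn y (Icc 0 1) ∧ y 1 = 0 ∧
      ∀ v ∈ Ioo (0 : ℝ) 1, HasDerivAt y (c * reductionR ε (max (y v) 0) - f v) v := by
  set Φ : ℝ → ℝ := fun y => reductionR ε (max y 0) with hΦ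
  have hΦm : Monotone Φ := fun x y hxy =>
    reductionR_mono hε (le_max_right _ _) (max_le_max_right 0 hxy)
  let δ : ℕ → ℝ := fun n => 1 / (n + 1)
  have hδ : ∀ n, 0 < δ n := fun n => by positivity
  have hδ0 : Tendsto δ atTop (𝓝 0) := tendsto_one_div_add_atTop_nhds_zero_nat
  -- With this choice the Hölder bound `√(2 / ε * d n)` is exactly `δ n`.
  let d : ℕ → ℝ := fun n => ε / 2 * δ n ^ 2
  have hd : ∀ n, 0 < d n := fun n => by have := hδ n; positivity
  let Ψ : ℕ → ℝ → ℝ := fun n y => reductionR ε (max y 0 + d n)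
  have hΨ : ∀ n y, |Ψ n y - Φ y| ≤ δ n := fun n y => by
    have h := abs_reductionR_sub_le hε (x := max y 0 + d n) (y := max y 0)
      (add_nonneg (le_max_right _ _) (hd n).le) (le_max_right _ _)
    rwa [add_sub_cancel_left, abs_of_pos (hd n), show 2 / ε * d n = δ n ^ 2 by
      simp only [d]; field_simp, Real.sqrt_sq (hδ n).le] at h
  have hex : ∀ n, ∃ y : ℝ → ℝ, ContinuousOn y (Icc 0 1) ∧ y 1 = 0 ∧
      ∀ v ∈ Ioo (0 : ℝ) 1, HasDerivAt y (c * Ψ n (y v) - f v) v := fun n => by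
    have hL : 0 ≤ 2 / ε / reductionR ε (d n) :=
      div_nonneg (by positivity) (reductionR_pos hε (hd n)).le
    refine exists_terminal_of_lipschitz (K := Real.toNNReal (2 / ε / reductionR ε (d n))) c hf
      (LipschitzWith.of_dist_le_mul fun x y => ?_) fun y => ?_
    · rw [Real.coe_toNNReal _ hL, Real.dist_eq, Real.dist_eq]
      refine (abs_reductionR_sub_le_mul hε (hd n) (x := max x 0 + d n) (y := max y 0 + d n)
        (by simp) (by simp)).trans (mul_le_mul_of_nonneg_left ?_ hL)
      rw [add_sub_add_right_eq_sub]
      simpa using abs_max_sub_max_le_max x 0 y 0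
    · have h0 : 0 ≤ max y 0 + d n := add_nonneg (le_max_right _ _) (hd n).le
      rw [abs_of_nonneg (reductionR_nonneg hε h0)]
      exact (reductionR_lt_one hε h0).le
  choose y hyc hy1 hyd using hex
  have hcau : ∀ n m, ∀ v ∈ Icc (0 : ℝ) 1, |y n v - y m v| ≤ c * (δ n + δ m) := fun n m v hv => by
    rw [abs_le]
    have h1 := sub_le_of_terminal hc hΦm (hΨ n) (hΨ m) (hyc n) (hyc m) (by rw [hy1, hy1])
      (hyd n) (hyd m) v hv
    have h2 := sub_le_of_terminal hc hΦm (hΨ m) (hΨ n) (hyc m) (hyc n) (by rw [hy1, hy1])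
      (hyd m) (hyd n) v hv
    constructor <;> linarith
  have hlim : ∀ v, ∃ l, v ∈ Icc (0 : ℝ) 1 → Tendsto (fun n => y n v) atTop (𝓝 l) := fun v => by
    by_cases hv : v ∈ Icc (0 : ℝ) 1
    · have : CauchySeq fun n => y n v := by
        refine cauchySeq_of_le_tendsto_0 (fun n => c * (δ n + δ n)) (fun n m N hn hm => ?_) ?_
        · refine (hcau n m v hv).trans (mul_le_mul_of_nonneg_left (add_le_add ?_ ?_) hc)
          · exact one_div_le_one_div_of_le (by positivity) (by gcongr)
          · exact one_div_le_one_div_of_le (by positivity) (by gcongr)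
        · simpa using (hδ0.add hδ0).const_mul c
      obtain ⟨l, hl⟩ := cauchySeq_tendsto_of_complete this
      exact ⟨l, fun _ => hl⟩
    · exact ⟨0, fun h => (hv h).elim⟩
  choose Y hY using hlim
  have hYn : ∀ n, ∀ v ∈ Icc (0 : ℝ) 1, |Y v - y n v| ≤ c * δ n := fun n v hv => by
    have h1 : Tendsto (fun m => |y m v - y n v|) atTop (𝓝 |Y v - y n v|) :=
      ((hY v hv).sub_const _).abs
    have h2 : Tendsto (fun m => c * (δ m + δ n)) atTop (𝓝 (c * δ n)) := by
      simpa using (hδ0.add_const (δ n)).const_mul c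
    exact le_of_tendsto_of_tendsto' h1 h2 fun m => hcau m n v hv
  have hcδ : Tendsto (fun n => c * δ n) atTop (𝓝 0) := by simpa using hδ0.const_mul c
  have hunif : TendstoUniformlyOn y Y atTop (Icc 0 1) := by
    refine Metric.tendstoUniformlyOn_iff.2 fun η hη => ?_
    filter_upwards [hcδ.eventually (gt_mem_nhds hη)] with n hn v hv
    exact (hYn n v hv).trans_lt hn
  refine ⟨Y, hunif.continuousOn (Frequently.of_forall hyc), ?_, fun v hv => ?_⟩
  · refine tendsto_nhds_unique (hY 1 (by simp)) ?_
    simp only [hy1]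
    exact tendsto_const_nhds
  refine hasDerivAt_of_tendstoUniformlyOn (l := atTop) (s := Ioo 0 1) (f := y)
    (f' := fun n v => c * Ψ n (y n v) - f v) (g' := fun v => c * Φ (Y v) - f v) isOpen_Ioo ?_
    (Eventually.of_forall hyd) (fun v hv => hY v (Ioo_subset_Icc_self hv)) hv
  refine Metric.tendstoUniformlyOn_iff.2 fun η hη => ?_
  have h0 : Tendsto (fun n => c * (δ n + √(2 / ε * (c * δ n)))) atTop (𝓝 0) := by
    have := ((hδ0.add ((hcδ.const_mul (2 / ε)).sqrt)).const_mul c)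
    simpa using this
  filter_upwards [h0.eventually (gt_mem_nhds hη)] with n hn v hv
  refine lt_of_le_of_lt ?_ hn
  rw [Real.dist_eq, show c * Φ (Y v) - f v - (c * Ψ n (y n v) - f v) =
    c * ((Φ (Y v) - Φ (y n v)) - (Ψ n (y n v) - Φ (y n v))) by ring, abs_mul, abs_of_nonneg hc]
  refine mul_le_mul_of_nonneg_left ?_ hc
  refine (abs_sub _ _).trans ?_
  rw [add_comm]
  refine add_le_add (hΨ n _) ?_
  refine (abs_reductionR_sub_le hε (le_max_right _ _) (le_max_right _ _)).trans ?_
  refine Real.sqrt_le_sqrt (mul_le_mul_of_nonneg_left ?_ (by positivity))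
  refine le_trans ?_ (hYn n v (Ioo_subset_Icc_self hv))
  simpa using abs_max_sub_max_le_max (Y v) 0 (y n v) 0

/-! ### The primitive of the reaction term. -/

section primitive

variable {f : ℝ → ℝ}

lemma intervalIntegrable_of_continuousOn_Icc (hf : ContinuousOn f (Icc 0 1)) {a b : ℝ}
    (ha : a ∈ Icc (0 : ℝ) 1) (hb : b ∈ Icc (0 : ℝ) 1) :
    IntervalIntegrable f MeasureTheory.volume a b :=
  (hf.mono (ordConnected_Icc.uIcc_subset ha hb)).intervalIntegrable

lemma primitive_zero (f : ℝ → ℝ) : primitive f 0 = 0 := by simp [primitive]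

lemma primitive_sub (hf : ContinuousOn f (Icc 0 1)) {a b : ℝ} (ha : a ∈ Icc (0 : ℝ) 1)
    (hb : b ∈ Icc (0 : ℝ) 1) : primitive f b - primitive f a = ∫ s in a..b, f s :=
  intervalIntegral.integral_interval_sub_left
    (intervalIntegrable_of_continuousOn_Icc hf (by simp) hb)
    (intervalIntegrable_of_continuousOn_Icc hf (by simp) ha)

lemma hasDerivAt_primitive (hf : ContinuousOn f (Icc 0 1)) {v : ℝ} (hv : v ∈ Ioo (0 : ℝ) 1) :
    HasDerivAt (primitive f) (f v) v :=
  intervalIntegral.integral_hasDerivAt_right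
    (intervalIntegrable_of_continuousOn_Icc hf (by simp) (Ioo_subset_Icc_self hv))
    ((hf.mono Ioo_subset_Icc_self).stronglyMeasurableAtFilter isOpen_Ioo v hv)
    (hf.continuousAt (Icc_mem_nhds hv.1 hv.2))

lemma continuousOn_primitive (hf : ContinuousOn f (Icc 0 1)) :
    ContinuousOn (primitive f) (Icc 0 1) := by
  have := intervalIntegral.continuousOn_primitive_interval (f := f) (a := 0) (b := 1)
    (μ := MeasureTheory.volume) (by
      rw [uIcc_of_le zero_le_one]; exact hf.integrableOn_Icc)
  rwa [uIcc_of_le zero_le_one] at this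

lemma mul_sub_le_primitive_sub (hf : ContinuousOn f (Icc 0 1)) {a b C : ℝ} (ha : 0 ≤ a)
    (hab : a ≤ b) (hb : b ≤ 1) (h : ∀ s ∈ Icc a b, C ≤ f s) :
    C * (b - a) ≤ primitive f b - primitive f a := by
  have ha' : a ∈ Icc (0 : ℝ) 1 := ⟨ha, hab.trans hb⟩
  have hb' : b ∈ Icc (0 : ℝ) 1 := ⟨ha.trans hab, hb⟩
  rw [primitive_sub hf ha' hb']
  have := intervalIntegral.integral_mono_on hab intervalIntegrable_const
    (intervalIntegrable_of_continuousOn_Icc hf ha' hb') h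
  simp only [intervalIntegral.integral_const, smul_eq_mul] at this
  linarith

lemma primitive_sub_le_mul_sub (hf : ContinuousOn f (Icc 0 1)) {a b C : ℝ} (ha : 0 ≤ a)
    (hab : a ≤ b) (hb : b ≤ 1) (h : ∀ s ∈ Icc a b, f s ≤ C) :
    primitive f b - primitive f a ≤ C * (b - a) := by
  have ha' : a ∈ Icc (0 : ℝ) 1 := ⟨ha, hab.trans hb⟩
  have hb' : b ∈ Icc (0 : ℝ) 1 := ⟨ha.trans hab, hb⟩
  rw [primitive_sub hf ha' hb']
  have := intervalIntegral.integral_mono_on hab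
    (intervalIntegrable_of_continuousOn_Icc hf ha' hb') intervalIntegrable_const h
  simp only [intervalIntegral.integral_const, smul_eq_mul] at this
  linarith

lemma mul_sub_lt_primitive_sub (hf : ContinuousOn f (Icc 0 1)) {a b C : ℝ} (ha : 0 ≤ a)
    (hab : a < b) (hb : b ≤ 1) (h : ∀ s ∈ Ioo a b, C < f s) :
    C * (b - a) < primitive f b - primitive f a := by
  have hsub : Icc a b ⊆ Icc 0 1 := Icc_subset_Icc ha hb
  have hm : StrictMonoOn (fun v => primitive f v - C * v) (Icc a b) := by
    refine strictMonoOn_of_deriv_pos (convex_Icc a b)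
      (((continuousOn_primitive hf).mono hsub).sub (by fun_prop)) fun v hv => ?_
    rw [interior_Icc] at hv
    have hd := (hasDerivAt_primitive hf ⟨ha.trans_lt hv.1, hv.2.trans_le hb⟩).sub
      ((hasDerivAt_id v).const_mul C)
    have h3 := hd.deriv
    have h4 := h v hv
    have : deriv (fun v => primitive f v - C * v) v = f v - C * 1 := h3
    rw [this]
    linarith
  have := hm (left_mem_Icc.2 hab.le) (right_mem_Icc.2 hab.le) hab
  dsimp only at this
  linarith

lemma primitive_sub_lt_mul_sub (hf : ContinuousOn f (Icc 0 1)) {a b C : ℝ} (ha : 0 ≤ a)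
    (hab : a < b) (hb : b ≤ 1) (h : ∀ s ∈ Ioo a b, f s < C) :
    primitive f b - primitive f a < C * (b - a) := by
  have := mul_sub_lt_primitive_sub hf.neg (C := -C) ha hab hb fun s hs => neg_lt_neg (h s hs)
  have hneg : ∀ x, primitive (-f) x = -primitive f x := fun x => by simp [primitive]
  rw [hneg, hneg] at this
  linarith

end primitive

/-! ### Shape of the reaction term and the tangency point `p`. -/

/-- A reaction term increasing up to `m` and decreasing afterwards, with `p` the point where the
line through the origin supports the graph of the primitive. -/
structure IsReactionShape (f : ℝ → ℝ) (m p : ℝ) : Prop where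
  continuousOn : ContinuousOn f (Icc 0 1)
  pos : ∀ s ∈ Ioo (0 : ℝ) 1, 0 < f s
  linear_control : ∃ k : ℝ, 0 < k ∧ ∀ s ∈ Icc (0 : ℝ) 1, |f s| ≤ k * s ∧ |f s| ≤ k * (1 - s)
  m_pos : 0 < m
  m_lt : m < p
  lt_one : p < 1
  strictAntiOn : StrictAntiOn f (Icc m 1)
  primitive_eq : primitive f p = f p * p
  primitive_lt : ∀ s ∈ Ioo 0 p, primitive f s < f p * s
  primitive_le : ∀ s ∈ Icc (0 : ℝ) 1, primitive f s ≤ f p * s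
  root_le : ∀ u ∈ Icc (0 : ℝ) 1, primitive f u = u * f u → u ≤ p

/-- If `f b ≤ f a` with `a < b ≤ m`, the maximum over `[0, b]` is attained inside `(0, b)`,
producing a local maximum other than `m`. The decreasing side is the mirror image. -/
lemma strictMonoOn_of_unique_localMax {f : ℝ → ℝ} (hH : ConditionH f) (hA : IsTypeA f) {m : ℝ}
    (hm : m ∈ Ioo (0 : ℝ) 1) (hu : ∀ t ∈ Ioo (0 : ℝ) 1, IsLocalMax f t → t = m) :
    StrictMonoOn f (Icc 0 m) := by
  intro a ha b hb hab
  rcases ha.1.eq_or_lt with rfl | ha0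
  · rw [hH.zero]; exact hA b ⟨hab, hb.2.trans_lt hm.2⟩
  by_contra! hle
  have hsub : Icc 0 b ⊆ Icc 0 1 := Icc_subset_Icc_right (hb.2.trans hm.2.le)
  obtain ⟨t, ht, htm⟩ := isCompact_Icc.exists_isMaxOn (nonempty_Icc.2 hb.1) (hH.continuousOn.mono hsub)
  have hamem : a ∈ Icc 0 b := ⟨ha0.le, hab.le⟩
  have hfa : 0 < f a := hA a ⟨ha0, ha.2.trans_lt hm.2⟩
  have key : ∀ r ∈ Ioo 0 b, IsMaxOn f (Icc 0 b) r → False := fun r hr hrm => by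
    have := hu r ⟨hr.1, hr.2.trans_le (hb.2.trans hm.2.le)⟩
      (hrm.isLocalMax (Icc_mem_nhds hr.1 hr.2))
    linarith [hr.2, hb.2]
  rcases ht.2.eq_or_lt with rfl | htb
  · exact key a ⟨ha0, hab⟩ fun x hx => (htm hx).trans hle
  · refine key t ⟨lt_of_le_of_ne ht.1 ?_, htb⟩ htm
    rintro rfl
    have := htm hamem
    simp only [mem_ofPred_eq, hH.zero] at this
    linarith

lemma strictAntiOn_of_unique_localMax {f : ℝ → ℝ} (hH : ConditionH f) (hA : IsTypeA f) {m : ℝ}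
    (hm : m ∈ Ioo (0 : ℝ) 1) (hu : ∀ t ∈ Ioo (0 : ℝ) 1, IsLocalMax f t → t = m) :
    StrictAntiOn f (Icc m 1) := by
  intro a ha b hb hab
  rcases hb.2.eq_or_lt with rfl | hb1
  · rw [hH.one]; exact hA a ⟨hm.1.trans_le ha.1, hab⟩
  by_contra! hle
  have hsub : Icc a 1 ⊆ Icc 0 1 := Icc_subset_Icc_left (hm.1.le.trans ha.1)
  obtain ⟨t, ht, htm⟩ := isCompact_Icc.exists_isMaxOn (nonempty_Icc.2 ha.2) (hH.continuousOn.mono hsub)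
  have hbmem : b ∈ Icc a 1 := ⟨hab.le, hb1.le⟩
  have hfb : 0 < f b := hA b ⟨hm.1.trans_le hb.1, hb1⟩
  have key : ∀ r ∈ Ioo a 1, IsMaxOn f (Icc a 1) r → False := fun r hr hrm => by
    have := hu r ⟨(hm.1.trans_le ha.1).trans hr.1, hr.2⟩
      (hrm.isLocalMax (Icc_mem_nhds hr.1 hr.2))
    linarith [hr.1, ha.1]
  rcases ht.1.eq_or_lt with rfl | hta
  · exact key b ⟨hab, hb1⟩ fun x hx => (htm hx).trans hle
  · refine key t ⟨hta, lt_of_le_of_ne ht.2 ?_⟩ htm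
    rintro rfl
    have := htm hbmem
    simp only [mem_ofPred_eq, hH.one] at this
    linarith

/-- The primitive is convex on `[0, m]` and concave on `[m, 1]`, so a line through the origin
touches its graph from above at some `p > m`. This `p` is a zero of `F(v) - v f(v)`, which is
negative at `m` and equals `F(1) > 0` at `1`. -/
lemma exists_isReactionShape {f : ℝ → ℝ} (hH : ConditionH f) (hA : IsTypeA f)
    (hF : ConditionF f) : ∃ m p, IsReactionShape f m p := by
  obtain ⟨m, ⟨hm, -⟩, hu⟩ := hF.unique_localMax
  have hu' : ∀ t ∈ Ioo (0 : ℝ) 1, IsLocalMax f t → t = m := fun t ht h => hu t ⟨ht, h⟩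
  have hmono := strictMonoOn_of_unique_localMax hH hA hm hu'
  have hanti := strictAntiOn_of_unique_localMax hH hA hm hu'
  have hf := hH.continuousOn
  have h0 := primitive_zero f
  have hmlt : primitive f m < m * f m := by
    have := primitive_sub_lt_mul_sub hf (C := f m) le_rfl hm.1 hm.2.le fun s hs =>
      hmono ⟨hs.1.le, hs.2.le⟩ (right_mem_Icc.2 hm.1.le) hs.2
    linarith
  have h1 : 0 < primitive f 1 := by
    have := mul_sub_lt_primitive_sub hf (C := 0) le_rfl zero_lt_one le_rfl hA
    linarith
  have hcont : ContinuousOn (fun v => primitive f v - v * f v) (Icc m 1) :=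
    ((continuousOn_primitive hf).sub (continuousOn_id.mul hf)).mono (Icc_subset_Icc_left hm.1.le)
  obtain ⟨p, hp, hpe⟩ := intermediate_value_Ioo hm.2.le hcont
    (show (0 : ℝ) ∈ Ioo _ _ from ⟨by linarith, by simpa [hH.one] using h1⟩)
  have hpe' : primitive f p = f p * p := by dsimp only at hpe; linarith
  have hpI : p ∈ Icc (0 : ℝ) 1 := ⟨hm.1.le.trans hp.1.le, hp.2.le⟩
  have hpm : p ∈ Icc m 1 := ⟨hp.1.le, hp.2.le⟩
  have hright : ∀ s, m ≤ s → s < p → primitive f s < f p * s := fun s hs hsp => by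
    have := mul_sub_lt_primitive_sub hf (C := f p) (hm.1.le.trans hs) hsp hp.2.le fun r hr =>
      hanti ⟨hs.trans hr.1.le, hr.2.le.trans hp.2.le⟩ hpm hr.2
    linarith
  have hlt : ∀ s ∈ Ioo 0 p, primitive f s < f p * s := fun s hs => by
    rcases le_total m s with h | h
    · exact hright s h hs.2
    have hs0 := hs.1
    have hsm : s ∈ Icc 0 m := ⟨hs0.le, h⟩
    have h2 := primitive_sub_le_mul_sub hf (C := f s) le_rfl hs0.le (h.trans hm.2.le) fun r hr =>
      hmono.monotoneOn ⟨hr.1, hr.2.trans h⟩ hsm hr.2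
    have h3 := mul_sub_le_primitive_sub hf (C := f s) hs0.le h hm.2.le fun r hr =>
      hmono.monotoneOn hsm ⟨hs0.le.trans hr.1, hr.2⟩ hr.1
    have h4 := hright m le_rfl hp.1
    -- Convexity on `[0, m]`: the chord slope `F(s) / s` is at most `F(m) / m`.
    have h5 : m * primitive f s ≤ s * primitive f m := by nlinarith
    have h6 : m * primitive f s < m * (f p * s) := by nlinarith
    exact lt_of_mul_lt_mul_left h6 hm.1.le
  refine ⟨m, p, hf, hA, hH.linear_control, hm.1, hp.1, hp.2, hanti, hpe', hlt,
    fun s hs => ?_, fun u hu hue => ?_⟩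
  · rcases hs.1.eq_or_lt with rfl | hs0
    · simp [h0]
    rcases lt_or_ge s p with h | h
    · exact (hlt s ⟨hs0, h⟩).le
    have := primitive_sub_le_mul_sub hf (C := f p) hpI.1 h hs.2 fun r hr =>
      hanti.antitoneOn hpm ⟨hp.1.le.trans hr.1, hr.2.trans hs.2⟩ hr.1
    linarith
  -- For `u > p`, `F(u) ≥ p f(p) + (u - p) f(u) > u f(u)`.
  · by_contra! hpu
    have h2 := mul_sub_le_primitive_sub hf (C := f u) hpI.1 hpu.le hu.2 fun r hr =>
      hanti.antitoneOn ⟨hp.1.le.trans hr.1, hr.2.trans hu.2⟩ ⟨hp.1.le.trans hpu.le, hu.2⟩ hr.2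
    have h3 := hanti hpm ⟨hp.1.le.trans hpu.le, hu.2⟩ hpu
    nlinarith [hm.1.trans hp.1]

/-! ### Terminal solutions: comparison, dependence on the speed, existence. -/

/-- Solutions of the first-order reduction that vanish at `v = 1`. -/
structure IsTerminalSolution (f : ℝ → ℝ) (ε c : ℝ) (y : ℝ → ℝ) : Prop where
  continuousOn : ContinuousOn y (Icc 0 1)
  one : y 1 = 0
  pos : ∀ v ∈ Ioo (0 : ℝ) 1, 0 < y v
  hasDerivAt : ∀ v ∈ Ioo (0 : ℝ) 1, HasDerivAt y (c * reductionR ε (y v) - f v) v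

namespace IsTerminalSolution

variable {f y y₁ y₂ u : ℝ → ℝ} {ε c c₁ c₂ a b : ℝ}

lemma nonneg (h : IsTerminalSolution f ε c y) {v : ℝ} (hv : v ∈ Icc (0 : ℝ) 1) : 0 ≤ y v := by
  have hcl : closure (Ioo (0 : ℝ) 1) = Icc 0 1 := closure_Ioo zero_ne_one
  have := ContinuousWithinAt.closure_le (s := Ioo (0 : ℝ) 1) (f := fun _ => (0 : ℝ)) (g := y)
    (by rwa [hcl]) continuousWithinAt_const ((h.continuousOn v hv).mono Ioo_subset_Icc_self)
    (fun v hv => (h.pos v hv).le)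
  exact this

/-- Comparison with supersolutions, backwards from the right end point. -/
lemma le_of_supersolution (h : IsTerminalSolution f ε c y) (hε : 0 < ε) (hc : 0 ≤ c)
    (ha : 0 ≤ a) (hb : b ≤ 1) (hu : ContinuousOn u (Icc a b))
    (hd : ∀ v ∈ Ioo a b, 0 ≤ u v ∧ ∃ d, HasDerivAt u d v ∧ d ≤ c * reductionR ε (u v) - f v)
    (hub : y b ≤ u b) {v : ℝ} (hv : v ∈ Icc a b) : y v ≤ u v := by
  have := nonpos_of_hasDerivAt_nonneg (w := fun v => y v - u v)
    ((h.continuousOn.mono (Icc_subset_Icc ha hb)).sub hu) (fun x hx hpos => ?_)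
    (sub_nonpos.2 hub) v hv
  · exact sub_nonpos.1 this
  · obtain ⟨h0, d, hd, hle⟩ := hd x hx
    refine ⟨_, ?_, (h.hasDerivAt x ⟨ha.trans_lt hx.1, hx.2.trans_le hb⟩).sub hd⟩
    have := mul_le_mul_of_nonneg_left (reductionR_mono hε h0 (sub_pos.1 hpos).le) hc
    linarith

lemma le_of_speed_le (h₁ : IsTerminalSolution f ε c₁ y₁) (h₂ : IsTerminalSolution f ε c₂ y₂)
    (hε : 0 < ε) (hc₁ : 0 ≤ c₁) (hc : c₁ ≤ c₂) {v : ℝ} (hv : v ∈ Icc (0 : ℝ) 1) :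
    y₂ v ≤ y₁ v := by
  refine h₂.le_of_supersolution hε (hc₁.trans hc) le_rfl le_rfl h₁.continuousOn (fun x hx => ?_)
    (by rw [h₁.one, h₂.one]) hv
  refine ⟨(h₁.pos x hx).le, _, h₁.hasDerivAt x hx, ?_⟩
  have := mul_le_mul_of_nonneg_right hc (reductionR_nonneg hε (h₁.pos x hx).le)
  linarith

/-- Because `R < 1`, adding `(c₂ - c₁)(1 - v)` to `y₂` gives a supersolution at speed `c₁`. This
continuity in the speed makes the set of admissible speeds closed. -/
lemma sub_le_speed_sub (h₁ : IsTerminalSolution f ε c₁ y₁) (h₂ : IsTerminalSolution f ε c₂ y₂)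
    (hε : 0 < ε) (hc₁ : 0 ≤ c₁) (hc : c₁ ≤ c₂) : y₁ 0 - y₂ 0 ≤ c₂ - c₁ := by
  have := h₁.le_of_supersolution (a := 0) (b := 1) (u := fun v => y₂ v + (c₂ - c₁) * (1 - v))
    hε hc₁ le_rfl le_rfl (h₂.continuousOn.add (by fun_prop)) (fun x hx => ?_)
    (by simp [h₁.one, h₂.one]) (left_mem_Icc.2 zero_le_one)
  · linarith
  · have hp := h₂.pos x hx
    have h0 : 0 ≤ (c₂ - c₁) * (1 - x) := mul_nonneg (by linarith) (by linarith [hx.2])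
    refine ⟨by linarith, _, (h₂.hasDerivAt x hx).add
      (((hasDerivAt_id x).const_sub 1).const_mul (c₂ - c₁)), ?_⟩
    have h3 := mul_le_mul_of_nonneg_left (reductionR_mono hε hp.le
      (show y₂ x ≤ y₂ x + (c₂ - c₁) * (1 - x) by linarith)) hc₁
    have h4 := mul_le_mul_of_nonneg_left (reductionR_lt_one hε hp.le).le
      (show 0 ≤ c₂ - c₁ by linarith)
    linarith

/-- The derivative is `c (R(y) - 1)`. Compared between `p` and another point, this gives the lower
bound on admissible speeds and the bounds on `y` used as `ε` vanishes. -/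
lemma antitoneOn_add_primitive_sub (h : IsTerminalSolution f ε c y)
    (hf : ContinuousOn f (Icc 0 1)) (hε : 0 < ε) (hc : 0 ≤ c) :
    AntitoneOn (fun v => y v + primitive f v - c * v) (Icc 0 1) := by
  have hd : ∀ v ∈ Ioo (0 : ℝ) 1, HasDerivAt (fun v => y v + primitive f v - c * v)
      (c * reductionR ε (y v) - f v + f v - c * 1) v := fun v hv =>
    ((h.hasDerivAt v hv).add (hasDerivAt_primitive hf hv)).sub ((hasDerivAt_id v).const_mul c)
  refine antitoneOn_of_deriv_nonpos (convex_Icc 0 1)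
    ((h.continuousOn.add (continuousOn_primitive hf)).sub (by fun_prop)) ?_ ?_
  · rw [interior_Icc]
    exact fun v hv => (hd v hv).differentiableAt.differentiableWithinAt
  · rw [interior_Icc]
    intro v hv
    rw [(hd v hv).deriv]
    have := mul_le_mul_of_nonneg_left (reductionR_lt_one hε (h.pos v hv).le).le hc
    linarith

end IsTerminalSolution

/-- The truncation in `exists_terminal` is harmless: where `y < 0` one has `y' = -f < 0`,
incompatible with `y(1) = 0`, and an interior zero would be a minimum with derivative `-f ≠ 0`. -/
lemma exists_isTerminalSolution {f : ℝ → ℝ} {ε c : ℝ} (hε : 0 < ε) (hc : 0 ≤ c)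
    (hf : ContinuousOn f (Icc 0 1)) (hpos : ∀ s ∈ Ioo (0 : ℝ) 1, 0 < f s) :
    ∃ y, IsTerminalSolution f ε c y := by
  obtain ⟨y, hy, h1, hd⟩ := exists_terminal hε hc hf
  have hnn : ∀ x ∈ Icc (0 : ℝ) 1, 0 ≤ y x := fun x hx => by
    have := nonpos_of_hasDerivAt_nonneg (w := fun v => -y v) hy.neg (fun v hv hlt => ?_)
      (by simp [h1]) x hx
    · exact neg_nonpos.1 this
    · refine ⟨_, ?_, (hd v hv).neg⟩
      rw [max_eq_right (by linarith), reductionR_zero]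
      linarith [hpos v hv]
  have hp : ∀ x ∈ Ioo (0 : ℝ) 1, 0 < y x := fun x hx => by
    refine lt_of_le_of_ne (hnn x (Ioo_subset_Icc_self hx)) fun h0 => ?_
    have hmin : IsLocalMin y x := by
      filter_upwards [Icc_mem_nhds hx.1 hx.2] with v hv
      rw [← h0]; exact hnn v hv
    have := hmin.hasDerivAt_eq_zero (hd x hx)
    rw [← h0, max_self, reductionR_zero] at this
    linarith [hpos x hx]
  refine ⟨y, hy, h1, hp, fun v hv => ?_⟩
  have := hd v hv
  rwa [max_eq_left (hp v hv).le] at this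

/-- A negative speed would make `y` strictly decreasing, against `y 0 = y 1`. -/
lemma isAdmissibleSpeed_iff {f : ℝ → ℝ} {ε c : ℝ} (hpos : ∀ s ∈ Ioo (0 : ℝ) 1, 0 < f s)
    (hε : 0 < ε) :
    IsAdmissibleSpeed f ε c ↔ 0 ≤ c ∧ ∃ y, IsTerminalSolution f ε c y ∧ y 0 = 0 := by
  constructor
  · rintro ⟨y, hy, h0, h1, hd⟩
    refine ⟨?_, y, ⟨hy, h1, fun v hv => (hd v hv).1, fun v hv => (hd v hv).2⟩, h0⟩
    by_contra! hc
    have : StrictAntiOn y (Icc 0 1) := by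
      refine strictAntiOn_of_deriv_neg (convex_Icc 0 1) hy fun v hv => ?_
      rw [interior_Icc] at hv
      rw [(hd v hv).2.deriv]
      have := mul_nonpos_of_nonpos_of_nonneg hc.le (reductionR_nonneg hε (hd v hv).1.le)
      linarith [hpos v hv]
    have := this (left_mem_Icc.2 zero_le_one) (right_mem_Icc.2 zero_le_one) zero_lt_one
    linarith
  · rintro ⟨-, y, hy, h0⟩
    exact ⟨y, hy.continuousOn, h0, hy.one, fun v hv => ⟨hy.pos v hv, hy.hasDerivAt v hv⟩⟩

/-! ### The critical speed and its bounds. -/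

namespace IsReactionShape

variable {f : ℝ → ℝ} {m p ε c : ℝ}

lemma p_pos (h : IsReactionShape f m p) : 0 < p := h.m_pos.trans h.m_lt

lemma p_mem (h : IsReactionShape f m p) : p ∈ Ioo (0 : ℝ) 1 := ⟨h.p_pos, h.lt_one⟩

lemma f_p_pos (h : IsReactionShape f m p) : 0 < f p := h.pos p h.p_mem

/-- Admissible speeds exceed `f p`. -/
lemma lt_of_isAdmissibleSpeed (h : IsReactionShape f m p) (hε : 0 < ε)
    (hc : IsAdmissibleSpeed f ε c) : f p < c := by
  obtain ⟨hc0, y, hy, hy0⟩ := (isAdmissibleSpeed_iff h.pos hε).1 hc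
  -- Between `0` and `p` this reads `y p + p f(p) ≤ c p`, with `y p > 0`.
  have h1 := hy.antitoneOn_add_primitive_sub h.continuousOn hε hc0 (left_mem_Icc.2 zero_le_one)
    (Ioo_subset_Icc_self h.p_mem) h.p_pos.le
  simp only [hy0, primitive_zero, h.primitive_eq] at h1
  have h2 := hy.pos p h.p_mem
  exact lt_of_mul_lt_mul_right (show f p * p < c * p by linarith) h.p_pos.le

/-- Speeds slightly larger than `f p` are admissible for small `ε`. -/
lemma isAdmissibleSpeed_of_le (h : IsReactionShape f m p) (hε : 0 < ε) {k η : ℝ} (hη : 0 < η)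
    (hk : ∀ s ∈ Icc (0 : ℝ) 1, f s ≤ k * s) (hεη : 4 * k * ε ≤ η ^ 2) :
    IsAdmissibleSpeed f ε (f p + η) := by
  have hc0 : 0 ≤ f p + η := by linarith [h.f_p_pos]
  obtain ⟨y, hy⟩ := exists_isTerminalSolution hε hc0 h.continuousOn h.pos
  refine (isAdmissibleSpeed_iff h.pos hε).2 ⟨hc0, y, hy, ?_⟩
  -- With `R` replaced by `1`, the reduction integrates to `c v - F`. Half of the margin `η` keeps
  -- `q ≥ η v / 2`; the other half pays for `R < 1`. The supersolution `√(ε² + q²) - ε` vanishes at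
  -- `0`, hence so does `y`.
  set q : ℝ → ℝ := fun v => (f p + η / 2) * v - primitive f v with hq
  have hq_ge : ∀ v ∈ Icc (0 : ℝ) 1, η / 2 * v ≤ q v := fun v hv => by
    have := h.primitive_le v hv
    simp only [hq]; linarith
  have hq_nn : ∀ v ∈ Icc (0 : ℝ) 1, 0 ≤ q v := fun v hv =>
    (mul_nonneg (by positivity) hv.1).trans (hq_ge v hv)
  have hqc : ContinuousOn q (Icc 0 1) :=
    ContinuousOn.sub (by fun_prop) (continuousOn_primitive h.continuousOn)
  have hge : ∀ x : ℝ, ε ≤ √(ε ^ 2 + x ^ 2) := fun x =>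
    Real.le_sqrt_of_sq_le (by nlinarith [sq_nonneg x])
  have hle := hy.le_of_supersolution (a := 0) (b := 1) (u := fun v => √(ε ^ 2 + q v ^ 2) - ε)
    hε hc0 le_rfl le_rfl (((continuousOn_const.add (hqc.pow 2)).sqrt).sub continuousOn_const)
    (fun v hv => ?_) (by rw [hy.one]; linarith [hge (q 1)]) (left_mem_Icc.2 zero_le_one)
  · have h0 : q 0 = 0 := by simp [hq, primitive_zero]
    simp only [h0, ne_eq, OfNat.ofNat_ne_zero, not_false_eq_true, zero_pow, add_zero,
      Real.sqrt_sq hε.le, sub_self] at hle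
    exact le_antisymm hle (hy.nonneg (by simp))
  · have hvI := Ioo_subset_Icc_self hv
    refine ⟨by linarith [hge (q v)], ?_⟩
    have hqd : HasDerivAt q ((f p + η / 2) * 1 - f v) v :=
      ((hasDerivAt_id v).const_mul _).sub (hasDerivAt_primitive h.continuousOn hv)
    have hS0 : 0 < ε ^ 2 + q v ^ 2 := by positivity
    have hS : 0 < √(ε ^ 2 + q v ^ 2) := Real.sqrt_pos.2 hS0
    have hSle : √(ε ^ 2 + q v ^ 2) ≤ ε + q v := by
      rw [Real.sqrt_le_left (by linarith [hq_nn v hvI])]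
      nlinarith [hq_nn v hvI]
    refine ⟨_, (((hqd.pow 2).const_add (ε ^ 2)).sqrt hS0.ne').sub_const ε, ?_⟩
    rw [reductionR_sqrt_sub hε (hq_nn v hvI)]
    have h1 := hq_ge v hvI
    have h2 := hk v hvI
    have h3 := h.pos v hv
    -- The condition on `ε` enters here: `f ε ≤ k v ε ≤ (η/2)² v ≤ q η/2`.
    have h4 : f v * ε ≤ q v * (η / 2) := by
      have : f v * ε ≤ k * v * ε := mul_le_mul_of_nonneg_right h2 hε.le
      have h5 : η / 2 * v * (η / 2) ≤ q v * (η / 2) :=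
        mul_le_mul_of_nonneg_right h1 (by positivity)
      nlinarith [hv.1]
    have h6 : f v * √(ε ^ 2 + q v ^ 2) ≤ q v * (η / 2 + f v) := by
      have := mul_le_mul_of_nonneg_left hSle h3.le
      linarith
    rw [← sub_nonneg]
    have h7 : (f p + η) * (q v / √(ε ^ 2 + q v ^ 2)) - f v -
        ((2 : ℕ) * q v ^ (2 - 1) * ((f p + η / 2) * 1 - f v)) / (2 * √(ε ^ 2 + q v ^ 2)) =
        (q v * (η / 2 + f v) - f v * √(ε ^ 2 + q v ^ 2)) / √(ε ^ 2 + q v ^ 2) := by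
      field_simp
      push_cast
      ring
    exact (div_nonneg (by linarith) hS.le).trans_eq h7.symm

/-- Existence of the critical speed, with its behaviour as `ε` vanishes. -/
lemma exists_isCriticalSpeed (h : IsReactionShape f m p) (hε : 0 < ε) {k : ℝ} (hk0 : 0 < k)
    (hk : ∀ s ∈ Icc (0 : ℝ) 1, f s ≤ k * s) :
    ∃ c, IsCriticalSpeed f ε c ∧ f p < c ∧ c ≤ f p + √(4 * k * ε) := by
  set S := {c : ℝ | IsAdmissibleSpeed f ε c} with hS
  have hmem : f p + √(4 * k * ε) ∈ S :=
    h.isAdmissibleSpeed_of_le hε (Real.sqrt_pos.2 (by positivity)) hk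
      (by rw [Real.sq_sqrt (by positivity)])
  have hbd : BddBelow S := ⟨f p, fun c hc => (h.lt_of_isAdmissibleSpeed hε hc).le⟩
  have hup : ∀ c ∈ S, ∀ c' ≥ c, c' ∈ S := fun c hc c' hcc => by
    obtain ⟨hc0, y, hy, hy0⟩ := (isAdmissibleSpeed_iff h.pos hε).1 hc
    obtain ⟨y', hy'⟩ := exists_isTerminalSolution hε (hc0.trans hcc) h.continuousOn h.pos
    refine (isAdmissibleSpeed_iff h.pos hε).2 ⟨hc0.trans hcc, y', hy', ?_⟩
    have := hy.le_of_speed_le hy' hε hc0 hcc (v := 0) (by simp)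
    exact le_antisymm (this.trans_eq hy0) (hy'.nonneg (by simp))
  have hge : f p ≤ sInf S := le_csInf ⟨_, hmem⟩ fun c hc => (h.lt_of_isAdmissibleSpeed hε hc).le
  have hc0 : 0 ≤ sInf S := h.f_p_pos.le.trans hge
  -- The infimum is attained: the solution at speed `sInf S` has `y 0 ≤ c - sInf S` for every
  -- admissible `c`.
  have hinf : sInf S ∈ S := by
    obtain ⟨y, hy⟩ := exists_isTerminalSolution hε hc0 h.continuousOn h.pos
    refine (isAdmissibleSpeed_iff h.pos hε).2 ⟨hc0, y, hy, ?_⟩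
    refine le_antisymm (le_of_forall_pos_le_add fun δ hδ => ?_) (hy.nonneg (by simp))
    obtain ⟨c, hc, hcδ⟩ := exists_lt_of_csInf_lt ⟨_, hmem⟩ (lt_add_of_pos_right (sInf S) hδ)
    obtain ⟨-, y', hy', hy0'⟩ := (isAdmissibleSpeed_iff h.pos hε).1 hc
    have := hy.sub_le_speed_sub hy' hε hc0 (csInf_le hbd hc)
    linarith
  exact ⟨sInf S, Set.ext fun c => ⟨fun hc => csInf_le hbd hc, fun hc => hup _ hinf c hc⟩,
    h.lt_of_isAdmissibleSpeed hε hinf, csInf_le hbd hmem⟩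

end IsReactionShape

/-! ### From a terminal solution to a profile. -/

lemma reductionR_div_sqrt {ε y : ℝ} (hε : 0 < ε) (hy : 0 ≤ y) :
    reductionR ε y / √(1 - reductionR ε y ^ 2) = √(y * (2 * ε + y)) / ε := by
  have h : 0 < ε + y := by linarith
  rw [reductionR_sq hε hy, sub_sub_cancel, Real.sqrt_sq (by positivity), reductionR]
  field_simp

lemma contDiffAt_reductionR {ε y : ℝ} (hε : 0 < ε) (hy : 0 < y) :
    ContDiffAt ℝ 1 (reductionR ε) y := by
  unfold reductionR
  refine ContDiffAt.div (ContDiffAt.sqrt (by fun_prop) (by positivity)) (by fun_prop) ?_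
  positivity

namespace IsTerminalSolution

variable {f y w : ℝ → ℝ} {ε c k : ℝ}

/-- Dropping `c R(y) ≥ 0` leaves `y' ≥ -k (1 - v)`, integrated from `1`. Quadratic decay of `y`
means linear decay of `R(y)`, so the value `1` is reached in infinite time only. -/
lemma le_sq (h : IsTerminalSolution f ε c y) (hε : 0 < ε) (hc : 0 ≤ c)
    (hk : ∀ s ∈ Icc (0 : ℝ) 1, |f s| ≤ k * (1 - s)) {v : ℝ} (hv : v ∈ Icc (0 : ℝ) 1) :
    y v ≤ k / 2 * (1 - v) ^ 2 := by
  have := nonpos_of_hasDerivAt_nonneg (w := fun v => y v - k / 2 * (1 - v) ^ 2) (a := 0) (b := 1)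
    (h.continuousOn.sub (by fun_prop)) (fun x hx _ => ?_) (by simp [h.one]) v hv
  · linarith
  · refine ⟨_, ?_, (h.hasDerivAt x hx).sub
      ((((hasDerivAt_id x).const_sub 1).pow 2).const_mul (k / 2))⟩
    have h1 := mul_nonneg hc (reductionR_nonneg hε (h.pos x hx).le)
    have h2 := le_of_abs_le (hk x (Ioo_subset_Icc_self hx))
    simp only [id_eq, Nat.cast_ofNat, Nat.add_one_sub_one, pow_one]
    linarith

/-- As `f > 0` and `R(y) ≤ √(2y/ε)`, the derivative of `√y` is at most `c √(2/ε) / 2`. This gives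
the linear bound on the speed at the end point `0`. -/
lemma sqrt_le_mul (h : IsTerminalSolution f ε c y) (hε : 0 < ε) (hc : 0 ≤ c) (h0 : y 0 = 0)
    (hpos : ∀ s ∈ Ioo (0 : ℝ) 1, 0 < f s) {v : ℝ} (hv : v ∈ Icc (0 : ℝ) 1) :
    √(y v) ≤ c * √(2 / ε) / 2 * v := by
  have hd : ∀ x ∈ Ioo (0 : ℝ) 1, HasDerivAt (fun v => √(y v) - c * √(2 / ε) / 2 * v)
      ((c * reductionR ε (y x) - f x) / (2 * √(y x)) - c * √(2 / ε) / 2 * 1) x := fun x hx =>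
    ((h.hasDerivAt x hx).sqrt (h.pos x hx).ne').sub ((hasDerivAt_id x).const_mul _)
  have hanti : AntitoneOn (fun v => √(y v) - c * √(2 / ε) / 2 * v) (Icc 0 1) := by
    refine antitoneOn_of_deriv_nonpos (convex_Icc 0 1) (h.continuousOn.sqrt.sub (by fun_prop)) ?_ ?_
    · rw [interior_Icc]
      exact fun x hx => (hd x hx).differentiableAt.differentiableWithinAt
    · rw [interior_Icc]
      intro x hx
      rw [(hd x hx).deriv]
      have hs := Real.sqrt_pos.2 (h.pos x hx)
      have h1 := reductionR_le_sqrt hε (h.pos x hx).le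
      rw [Real.sqrt_mul (by positivity)] at h1
      have h2 := mul_le_mul_of_nonneg_left h1 hc
      have h3 := hpos x hx
      rw [sub_nonpos, div_le_iff₀ (by positivity)]
      linarith
  have := hanti (left_mem_Icc.2 zero_le_one) hv hv.1
  simp only [h0, Real.sqrt_zero, mul_zero, sub_zero] at this
  linarith

/-- The first-order reduction gives the speed of a profile. -/
lemma isSpeedField (h : IsTerminalSolution f ε c y) (hε : 0 < ε) (hc : 0 ≤ c) (h0 : y 0 = 0)
    (hpos : ∀ s ∈ Ioo (0 : ℝ) 1, 0 < f s) (hk0 : 0 < k)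
    (hk : ∀ s ∈ Icc (0 : ℝ) 1, |f s| ≤ k * (1 - s)) :
    IsSpeedField fun s => reductionR ε (y s) := by
  refine ⟨(continuousOn_reductionR hε).comp (h.continuousOn.mono Ioo_subset_Icc_self)
    fun s hs => (h.pos s hs).le, fun s hs => reductionR_pos hε (h.pos s hs),
    √(2 / ε) * (c * √(2 / ε) / 2) + √(2 / ε * (k / 2)), by positivity, fun s hs => ?_⟩
  have hsI := Ioo_subset_Icc_self hs
  have hR := reductionR_le_sqrt hε (h.pos s hs).le
  constructor
  · have h1 := h.sqrt_le_mul hε hc h0 hpos hsI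
    rw [Real.sqrt_mul (by positivity)] at hR
    have h2 := mul_le_mul_of_nonneg_left h1 (Real.sqrt_nonneg (2 / ε))
    have h3 : 0 ≤ √(2 / ε * (k / 2)) * s := mul_nonneg (Real.sqrt_nonneg _) hs.1.le
    linarith
  · have h1 := h.le_sq hε hc hk hsI
    have h2 : √(2 / ε * y s) ≤ √(2 / ε * (k / 2) * (1 - s) ^ 2) := by
      refine Real.sqrt_le_sqrt ?_
      rw [mul_assoc]
      exact mul_le_mul_of_nonneg_left h1 (by positivity)
    rw [Real.sqrt_mul (by positivity : 0 ≤ 2 / ε * (k / 2)),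
      Real.sqrt_sq (by linarith [hs.2])] at h2
    have h3 : 0 ≤ √(2 / ε) * (c * √(2 / ε) / 2) * (1 - s) :=
      mul_nonneg (by positivity) (by linarith [hs.2])
    linarith

lemma contDiffOn (h : IsTerminalSolution f ε c y) (hε : 0 < ε) (hf : ContinuousOn f (Icc 0 1)) :
    ContDiffOn ℝ 1 y (Ioo 0 1) := by
  rw [show (1 : WithTop ℕ∞) = 0 + 1 from rfl, contDiffOn_succ_iff_deriv_of_isOpen isOpen_Ioo]
  refine ⟨fun v hv => (h.hasDerivAt v hv).differentiableAt.differentiableWithinAt, by simp, ?_⟩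
  rw [contDiffOn_zero]
  refine ContinuousOn.congr (f := fun v => c * reductionR ε (y v) - f v) ?_
    fun v hv => (h.hasDerivAt v hv).deriv
  exact (continuousOn_const.mul ((continuousOn_reductionR hε).comp
    (h.continuousOn.mono Ioo_subset_Icc_self) fun s hs => (h.pos s hs).le)).sub
    (hf.mono Ioo_subset_Icc_self)

/-- The flow of the first-order reduction is a heteroclinic. -/
lemma isHeteroclinic_flow (h : IsTerminalSolution f ε c y) (hε : 0 < ε)
    (hf : ContinuousOn f (Icc 0 1)) (hG : IsSpeedField fun s => reductionR ε (y s)) :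
    IsHeteroclinic f ε c hG.flow := by
  have hderiv : deriv hG.flow = fun z => reductionR ε (y (hG.flow z)) :=
    funext fun z => (hG.hasDerivAt_flow z).deriv
  have hdiff : Differentiable ℝ hG.flow := fun z => (hG.hasDerivAt_flow z).differentiableAt
  have hRy : ContDiffOn ℝ 1 (fun s => reductionR ε (y s)) (Ioo 0 1) := fun s hs =>
    (contDiffAt_reductionR hε (h.pos s hs)).comp_contDiffWithinAt s (h.contDiffOn hε hf s hs)
  have h1 : ContDiff ℝ 1 hG.flow := by
    rw [contDiff_one_iff_deriv, hderiv]
    exact ⟨hdiff, hG.continuousOn.comp_continuous hG.continuous_flow hG.flow_mem⟩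
  refine ⟨?_, fun z => ?_, fun z => ?_, hG.strictMono_flow.monotone, hG.tendsto_flow_atBot,
    hG.tendsto_flow_atTop⟩
  · rw [show (2 : WithTop ℕ∞) = 1 + 1 from rfl, contDiff_succ_iff_deriv, hderiv]
    exact ⟨hdiff, by simp, hRy.comp_contDiff h1 hG.flow_mem⟩
  · have hp := (h.pos _ (hG.flow_mem z)).le
    rw [hderiv, abs_of_nonneg (reductionR_nonneg hε hp)]
    exact reductionR_lt_one hε hp
  · have hp := h.pos _ (hG.flow_mem z)
    have hY : HasDerivAt (fun z => y (hG.flow z)) _ z :=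
      (h.hasDerivAt _ (hG.flow_mem z)).comp z (hG.hasDerivAt_flow z)
    set Y := fun z => y (hG.flow z) with hYdef
    have hpY : 0 < Y z := hp
    have hq : (fun x => deriv hG.flow x / √(1 - deriv hG.flow x ^ 2)) =
        fun x => √(Y x * (2 * ε + Y x)) / ε := funext fun x => by
      rw [hderiv]
      exact reductionR_div_sqrt hε (h.pos _ (hG.flow_mem x)).le
    have hS : 0 < Y z * (2 * ε + Y z) := by positivity
    set g := c * reductionR ε (Y z) - f (hG.flow z) with hg
    have hY' : HasDerivAt Y (g * reductionR ε (Y z)) z := hY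
    have hd : HasDerivAt (fun x => √(Y x * (2 * ε + Y x)) / ε)
        ((g * reductionR ε (Y z) * (2 * ε + Y z) + Y z * (g * reductionR ε (Y z))) /
          (2 * √(Y z * (2 * ε + Y z))) / ε) z :=
      ((hY'.mul (hY'.const_add (2 * ε))).sqrt hS.ne').div_const ε
    have hdz : deriv hG.flow z = reductionR ε (Y z) := congrFun hderiv z
    rw [hq, hd.deriv, hdz]
    have hS' := Real.sqrt_pos.2 hS
    -- The flux `√(Y (2ε + Y)) / ε` has derivative `(ε + Y) Y' / (ε √(Y (2ε + Y)))` with `Y' = g R`;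
    -- this identity reduces it to `g / ε`.
    have hR : reductionR ε (Y z) * (ε + Y z) = √(Y z * (2 * ε + Y z)) := by
      rw [reductionR]; field_simp
    rw [← hR] at hS' ⊢
    have h2 : 0 < ε + Y z := by positivity
    have h3 := reductionR_pos hε hpY
    have h4 : ε * ((g * reductionR ε (Y z) * (2 * ε + Y z) + Y z * (g * reductionR ε (Y z))) /
        (2 * (reductionR ε (Y z) * (ε + Y z))) / ε) = g := by
      field_simp
      ring
    rw [h4]
    linarith

end IsTerminalSolution

/-! ### Every heteroclinic obeys the first-order reduction. -/

namespace IsHeteroclinic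

variable {f w y : ℝ → ℝ} {ε c k : ℝ}

lemma mem_Icc (h : IsHeteroclinic f ε c w) (z : ℝ) : w z ∈ Icc (0 : ℝ) 1 :=
  ⟨h.monotone.le_of_tendsto h.tendsto_atBot z, h.monotone.ge_of_tendsto h.tendsto_atTop z⟩

lemma hasDerivAt (h : IsHeteroclinic f ε c w) (z : ℝ) : HasDerivAt w (deriv w z) z :=
  (h.contDiff.differentiable (by simp) z).hasDerivAt

lemma deriv_nonneg (h : IsHeteroclinic f ε c w) (z : ℝ) : 0 ≤ deriv w z :=
  h.monotone.deriv_nonneg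

lemma one_sub_sq_pos (h : IsHeteroclinic f ε c w) (z : ℝ) : 0 < 1 - deriv w z ^ 2 := by
  have := h.abs_deriv_lt_one z
  rw [abs_of_nonneg (h.deriv_nonneg z)] at this
  nlinarith [h.deriv_nonneg z]

lemma hasDerivAt_flux (h : IsHeteroclinic f ε c w) (hε : 0 < ε) (z : ℝ) :
    HasDerivAt (fun x => deriv w x / √(1 - deriv w x ^ 2)) ((c * deriv w z - f (w z)) / ε) z := by
  have hd : DifferentiableAt ℝ (deriv w) z := by
    have := h.contDiff
    rw [show (2 : WithTop ℕ∞) = 1 + 1 from rfl, contDiff_succ_iff_deriv] at this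
    exact this.2.2.differentiable (by simp) z
  have hq : DifferentiableAt ℝ (fun x => deriv w x / √(1 - deriv w x ^ 2)) z :=
    hd.div (((hd.pow 2).const_sub 1).sqrt (h.one_sub_sq_pos z).ne')
      (Real.sqrt_pos.2 (h.one_sub_sq_pos z)).ne'
  refine hq.hasDerivAt.congr_deriv ?_
  rw [eq_div_iff hε.ne']
  linarith [h.equation z]

lemma deriv_le_flux (h : IsHeteroclinic f ε c w) (z : ℝ) :
    deriv w z ≤ deriv w z / √(1 - deriv w z ^ 2) := by
  rw [le_div_iff₀ (Real.sqrt_pos.2 (h.one_sub_sq_pos z))]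
  refine mul_le_of_le_one_right (h.deriv_nonneg z) (Real.sqrt_le_one.2 ?_)
  nlinarith [h.deriv_nonneg z]

/-- The sum `N` of the flux and `1 - w` satisfies `N' ≥ -(1 + k/ε) N`, so it stays positive to the
right of `0`. If `w` touched `1`, its slope would vanish there, and `N` with it. -/
lemma lt_one (h : IsHeteroclinic f ε c w) (hε : 0 < ε) (hc : 0 ≤ c) (h0 : w 0 < 1) (hk0 : 0 < k)
    (hk : ∀ s ∈ Icc (0 : ℝ) 1, |f s| ≤ k * (1 - s)) (z : ℝ) : w z < 1 := by
  rcases le_total z 0 with hz | hz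
  · exact (h.monotone hz).trans_lt h0
  have hN := pos_of_neg_mul_le_hasDerivAt (C := 1 + k / ε) (a := 0) (z := z)
    (fun x => (h.hasDerivAt_flux hε x).add ((h.hasDerivAt x).const_sub 1)) (fun x => ?_) ?_ hz
  · refine lt_of_le_of_ne (h.mem_Icc z).2 fun h1 => ?_
    have hmax : IsLocalMax w z := Eventually.of_forall fun x => h1 ▸ (h.mem_Icc x).2
    have := hmax.deriv_eq_zero
    simp [this, h1] at hN
  · have h1 := h.deriv_le_flux x
    have h2 := h.deriv_nonneg x
    have h3 := le_of_abs_le (hk _ (h.mem_Icc x))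
    have h4 := (h.mem_Icc x).2
    have h5 : (c * deriv w x - f (w x)) / ε ≥ -(k / ε * (1 - w x)) := by
      rw [ge_iff_le, le_div_iff₀ hε]
      have : -(k / ε * (1 - w x)) * ε = -(k * (1 - w x)) := by field_simp
      rw [this]
      linarith [mul_nonneg hc h2]
    have h6 : 0 ≤ k / ε * (deriv w x / √(1 - deriv w x ^ 2)) :=
      mul_nonneg (by positivity) (h2.trans h1)
    simp only [Pi.add_apply]
    linarith
  · have := (h.deriv_nonneg 0).trans (h.deriv_le_flux 0)
    simp only [Pi.add_apply]
    linarith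

/-- The same argument run to the left, with the flux plus `w`; here `f ≥ 0` suffices. -/
lemma pos (h : IsHeteroclinic f ε c w) (hε : 0 < ε) (hc : 0 ≤ c) (h0 : 0 < w 0)
    (hf : ∀ s ∈ Icc (0 : ℝ) 1, 0 ≤ f s) (z : ℝ) : 0 < w z := by
  rcases le_total 0 z with hz | hz
  · exact h0.trans_le (h.monotone hz)
  have hN := pos_of_hasDerivAt_le_mul (C := c / ε + 1) (a := 0) (z := z)
    (fun x => (h.hasDerivAt_flux hε x).add (h.hasDerivAt x)) (fun x => ?_) ?_ hz
  · refine lt_of_le_of_ne (h.mem_Icc z).1 fun h1 => ?_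
    have hmin : IsLocalMin w z := Eventually.of_forall fun x => h1 ▸ (h.mem_Icc x).1
    have := hmin.deriv_eq_zero
    simp [this, ← h1] at hN
  · have h1 := h.deriv_le_flux x
    have h3 := hf _ (h.mem_Icc x)
    have h4 := (h.mem_Icc x).1
    have h5 : (c * deriv w x - f (w x)) / ε ≤ c / ε * deriv w x := by
      rw [div_mul_eq_mul_div]
      exact div_le_div_of_nonneg_right (by linarith) hε.le
    have hce : 0 ≤ c / ε := div_nonneg hc hε.le
    have h6 := mul_le_mul_of_nonneg_left h1 hce
    have h7 := mul_nonneg hce h4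
    simp only [Pi.add_apply]
    linarith
  · have := (h.deriv_nonneg 0).trans (h.deriv_le_flux 0)
    simp only [Pi.add_apply]
    linarith

/-- The slope of a heteroclinic is arbitrarily small somewhere far to the right. -/
lemma exists_deriv_lt (h : IsHeteroclinic f ε c w) {ρ : ℝ} (hρ : 0 < ρ) (B : ℝ) :
    ∃ b ≥ B, deriv w b < ρ := by
  obtain ⟨b, hb, hbe⟩ := exists_hasDerivAt_eq_slope w (deriv w)
    (show B < B + 2 / ρ from lt_add_of_pos_right _ (by positivity))
    (h.contDiff.continuous.continuousOn) fun x _ => h.hasDerivAt x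
  refine ⟨b, hb.1.le, ?_⟩
  rw [hbe, add_sub_cancel_left, div_lt_iff₀ (by positivity), mul_div_cancel₀ _ hρ.ne']
  linarith [(h.mem_Icc (B + 2 / ρ)).2, (h.mem_Icc B).1]

/-- Heteroclinics are governed by the first-order reduction. -/
lemma hasDerivAt_reductionR (h : IsHeteroclinic f ε c w) (hy : IsTerminalSolution f ε c y)
    (hε : 0 < ε) (hc : 0 ≤ c) (hw : ∀ z, w z ∈ Ioo (0 : ℝ) 1) (z : ℝ) :
    HasDerivAt w (reductionR ε (y (w z))) z := by
  set Q : ℝ → ℝ := fun x => deriv w x / √(1 - deriv w x ^ 2) with hQ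
  -- `Y` is `ε (1 / √(1 - w'²) - 1)` expressed through the flux. Both `Y` and `y ∘ w` satisfy `u' =
  -- w' (c R(u) - f(w))`.
  set Y : ℝ → ℝ := fun x => √(ε ^ 2 + (ε * Q x) ^ 2) - ε with hYdef
  have hQ0 : ∀ x, 0 ≤ Q x := fun x => (h.deriv_nonneg x).trans (h.deriv_le_flux x)
  have hS : ∀ x, √(ε ^ 2 + (ε * Q x) ^ 2) = ε / √(1 - deriv w x ^ 2) := fun x => by
    have hr := Real.sqrt_pos.2 (h.one_sub_sq_pos x)
    have hr2 := Real.sq_sqrt (h.one_sub_sq_pos x).le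
    rw [Real.sqrt_eq_iff_mul_self_eq (by positivity) (by positivity)]
    simp only [hQ]
    field_simp
    rw [hr2]
    ring
  have hRY : ∀ x, reductionR ε (Y x) = deriv w x := fun x => by
    have hr := Real.sqrt_pos.2 (h.one_sub_sq_pos x)
    simp only [hYdef]
    rw [reductionR_sqrt_sub hε (mul_nonneg hε.le (hQ0 x)), hS]
    simp only [hQ]
    field_simp
  have hY0 : ∀ x, 0 ≤ Y x := fun x => by
    have : ε ≤ √(ε ^ 2 + (ε * Q x) ^ 2) := Real.le_sqrt_of_sq_le (by nlinarith [sq_nonneg (ε * Q x)])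
    simp only [hYdef]; linarith
  have hYd : ∀ x, HasDerivAt Y (deriv w x * (c * deriv w x - f (w x))) x := fun x => by
    have hpos : 0 < ε ^ 2 + (ε * Q x) ^ 2 := by positivity
    have h1 : HasDerivAt Y (((2 : ℕ) * (ε * Q x) ^ (2 - 1) *
        (ε * ((c * deriv w x - f (w x)) / ε))) / (2 * √(ε ^ 2 + (ε * Q x) ^ 2))) x :=
      (((((h.hasDerivAt_flux hε x).const_mul ε).pow 2).const_add (ε ^ 2)).sqrt hpos.ne').sub_const ε
    refine h1.congr_deriv ?_
    have hr := Real.sqrt_pos.2 (h.one_sub_sq_pos x)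
    rw [hS]
    simp only [hQ, Nat.cast_ofNat, Nat.add_one_sub_one, pow_one]
    field_simp
  have hyd : ∀ x, HasDerivAt (fun x => y (w x))
      ((c * reductionR ε (y (w x)) - f (w x)) * deriv w x) x := fun x =>
    (hy.hasDerivAt _ (hw x)).comp x (h.hasDerivAt x)
  have hycont : Tendsto (fun x => y (w x)) atTop (𝓝 0) := by
    rw [← hy.one]
    exact (hy.continuousOn 1 (by simp)).tendsto.comp
      (tendsto_nhdsWithin_iff.2 ⟨h.tendsto_atTop, Eventually.of_forall h.mem_Icc⟩)
  -- Backward comparison from a far point `b`, up to a margin `δ`. Smallness of `Y` is available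
  -- only at selected points `b`, where the slope is small; this is enough.
  have hle₁ : Y z ≤ y (w z) := by
    refine le_of_forall_pos_le_add fun δ hδ => ?_
    have hlim : Tendsto (fun r : ℝ => ε / √(1 - r ^ 2) - ε) (𝓝 0) (𝓝 0) := by
      have : ContinuousAt (fun r : ℝ => ε / √(1 - r ^ 2) - ε) 0 :=
        ((continuousAt_const.div (by fun_prop) (by simp))).sub continuousAt_const
      simpa [ContinuousAt] using this
    obtain ⟨ρ, hρ, hball⟩ := Metric.eventually_nhds_iff.1 (hlim.eventually (gt_mem_nhds hδ))
    obtain ⟨b, hzb, hb⟩ := h.exists_deriv_lt hρ z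
    have hYb : Y b < δ := by
      simp only [hYdef, hS]
      exact hball (by rwa [dist_zero_right, Real.norm_of_nonneg (h.deriv_nonneg b)])
    have := nonpos_of_hasDerivAt_nonneg (w := fun x => Y x - y (w x) - δ) (a := z) (b := b)
      (fun x _ => (((hYd x).sub (hyd x)).sub_const δ).continuousAt.continuousWithinAt)
      (fun x _ hpos => ⟨_, ?_, ((hYd x).sub (hyd x)).sub_const δ⟩) ?_ z (left_mem_Icc.2 hzb)
    · linarith
    · have h1 := reductionR_mono hε (hy.pos _ (hw x)).le (show y (w x) ≤ Y x by linarith)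
      rw [hRY] at h1
      have h2 := mul_nonneg (h.deriv_nonneg x) (mul_nonneg hc (sub_nonneg.2 h1))
      linarith
    · linarith [hy.pos _ (hw b)]
  have hle₂ : y (w z) ≤ Y z := by
    refine le_of_forall_pos_le_add fun δ hδ => ?_
    obtain ⟨b, hb, hzb⟩ := ((hycont.eventually (gt_mem_nhds hδ)).and (eventually_ge_atTop z)).exists
    have := nonpos_of_hasDerivAt_nonneg (w := fun x => y (w x) - Y x - δ) (a := z) (b := b)
      (fun x _ => (((hyd x).sub (hYd x)).sub_const δ).continuousAt.continuousWithinAt)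
      (fun x _ hpos => ⟨_, ?_, ((hyd x).sub (hYd x)).sub_const δ⟩) ?_ z (left_mem_Icc.2 hzb)
    · linarith
    · have h1 := reductionR_mono hε (hY0 x) (show Y x ≤ y (w x) by linarith)
      rw [hRY] at h1
      have h2 := mul_nonneg (h.deriv_nonneg x) (mul_nonneg hc (sub_nonneg.2 h1))
      linarith
    · linarith [hY0 b]
  rw [← le_antisymm hle₁ hle₂, hRY]
  exact h.hasDerivAt z

end IsHeteroclinic

/-! ### Limit of the slopes and of the time maps as `ε` vanishes. -/

/-- The limit, as `ε` vanishes, of the slope of the critical profile where its value is `s`. -/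
noncomputable def limitSpeed (f : ℝ → ℝ) (p s : ℝ) : ℝ := f (max s p) / f p

namespace IsReactionShape

variable {f y : ℝ → ℝ} {m p ε c : ℝ}

lemma limitSpeed_of_le (h : IsReactionShape f m p) {s : ℝ} (hs : s ≤ p) : limitSpeed f p s = 1 := by
  rw [limitSpeed, max_eq_right hs, div_self h.f_p_pos.ne']

lemma limitSpeed_of_ge {s : ℝ} (hs : p ≤ s) : limitSpeed f p s = f s / f p := by
  rw [limitSpeed, max_eq_left hs]

lemma limitSpeed_pos (h : IsReactionShape f m p) {s : ℝ} (hs : s ∈ Ioo (0 : ℝ) 1) :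
    0 < limitSpeed f p s :=
  div_pos (h.pos _ ⟨lt_max_of_lt_left hs.1, max_lt hs.2 h.lt_one⟩) h.f_p_pos

lemma continuousOn_limitSpeed (h : IsReactionShape f m p) :
    ContinuousOn (limitSpeed f p) (Ioo 0 1) := by
  refine ContinuousOn.div_const (h.continuousOn.comp (by fun_prop) fun s hs => ?_) _
  exact ⟨le_max_of_le_left hs.1.le, (max_lt hs.2 h.lt_one).le⟩

/-- Where `f` decreases, the solution stays below the nullcline. -/
lemma speed_mul_reductionR_le (h : IsReactionShape f m p) (hy : IsTerminalSolution f ε c y)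
    (hε : 0 < ε) (hc : 0 ≤ c) {v : ℝ} (hmv : m ≤ v) (hv1 : v < 1) :
    c * reductionR ε (y v) ≤ f v := by
  by_contra! hlt
  have hv0 : 0 < v := h.m_pos.trans_le hmv
  have hyv := hy.pos v ⟨hv0, hv1⟩
  have hcont : ContinuousAt (fun M => c * reductionR ε M) (y v) :=
    continuousAt_const.mul ((continuousOn_reductionR hε).continuousAt (Ici_mem_nhds hyv))
  have hev : ∀ᶠ M in 𝓝[<] (y v), f v < c * reductionR ε M ∧ 0 < M ∧ M < y v := by
    refine (((hcont.eventually (lt_mem_nhds hlt)).and (lt_mem_nhds hyv)).filter_mono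
      nhdsWithin_le_nhds |>.and self_mem_nhdsWithin).mono fun M hM => ⟨hM.1.1, hM.1.2, hM.2⟩
  obtain ⟨M, hM, hM0, hMy⟩ := hev.exists
  -- A constant `M` just below `y v` with `c R(M) > f v` is a supersolution on `[v, 1]`, where `f`
  -- decreases; so `y v ≤ M`, a contradiction.
  have := hy.le_of_supersolution (a := v) (b := 1) (u := fun _ => M) hε hc hv0.le le_rfl
    continuousOn_const (fun x hx => ⟨hM0.le, 0, hasDerivAt_const x M, ?_⟩)
    (by rw [hy.one]; exact hM0.le) (left_mem_Icc.2 hv1.le)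
  · linarith
  · have := h.strictAntiOn ⟨hmv, hv1.le⟩ ⟨hmv.trans hx.1.le, hx.2.le⟩ hx.1
    linarith

lemma antitoneOn_terminal (h : IsReactionShape f m p) (hy : IsTerminalSolution f ε c y)
    (hε : 0 < ε) (hc : 0 ≤ c) : AntitoneOn y (Icc m 1) := by
  have hd : ∀ v ∈ Ioo m 1, HasDerivAt y (c * reductionR ε (y v) - f v) v := fun v hv =>
    hy.hasDerivAt v ⟨h.m_pos.trans hv.1, hv.2⟩
  refine antitoneOn_of_deriv_nonpos (convex_Icc m 1)
    (hy.continuousOn.mono (Icc_subset_Icc_left h.m_pos.le)) ?_ ?_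
  · rw [interior_Icc]
    exact fun v hv => (hd v hv).differentiableAt.differentiableWithinAt
  · rw [interior_Icc]
    intro v hv
    rw [(hd v hv).deriv]
    exact sub_nonpos.2 (h.speed_mul_reductionR_le hy hε hc hv.1.le hv.2)

lemma terminal_p_le (h : IsReactionShape f m p) (hy : IsTerminalSolution f ε c y)
    (hy0 : y 0 = 0) (hε : 0 < ε) (hc : f p < c) : y p ≤ c - f p := by
  have h1 := hy.antitoneOn_add_primitive_sub h.continuousOn hε (h.f_p_pos.trans hc).le
    (left_mem_Icc.2 zero_le_one) (Ioo_subset_Icc_self h.p_mem) h.p_pos.le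
  simp only [hy0, primitive_zero, h.primitive_eq] at h1
  nlinarith [h.lt_one]

/-- Integrating from `v` to `p`: the gap between the tangent line and the primitive bounds `y` from
below, up to `c - f p`. -/
lemma le_terminal_of_le (h : IsReactionShape f m p) (hy : IsTerminalSolution f ε c y)
    (hε : 0 < ε) (hc : f p < c) {v : ℝ} (hv0 : 0 ≤ v) (hvp : v ≤ p) :
    f p * v - primitive f v - (c - f p) ≤ y v := by
  have h1 := hy.antitoneOn_add_primitive_sub h.continuousOn hε (h.f_p_pos.trans hc).le
    ⟨hv0, hvp.trans h.lt_one.le⟩ (Ioo_subset_Icc_self h.p_mem) hvp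
  simp only [h.primitive_eq] at h1
  have h2 := hy.pos p h.p_mem
  nlinarith [h.lt_one, mul_nonneg (sub_pos.2 hc).le hv0]

/-- On `[v, v']` both `y` and `f` decrease, so `y' ≤ c R(y v) - f v'`. The total drop of `y` is at
most `y p ≤ c - f p`, so `c R(y v)` cannot lie far below `f v'`. -/
lemma mul_sub_le_of_ge (h : IsReactionShape f m p) (hy : IsTerminalSolution f ε c y)
    (hy0 : y 0 = 0) (hε : 0 < ε) (hc : f p < c) {v v' : ℝ} (hpv : p ≤ v) (hvv : v < v')
    (hv' : v' ≤ 1) : (v' - v) * (f v' - c * reductionR ε (y v)) ≤ c - f p := by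
  have hc0 : 0 ≤ c := (h.f_p_pos.trans hc).le
  have hv0 : 0 < v := h.p_pos.trans_le hpv
  have hmv : m ≤ v := h.m_lt.le.trans hpv
  have hya := h.antitoneOn_terminal hy hε hc0
  have hsub : Icc v v' ⊆ Icc 0 1 := Icc_subset_Icc hv0.le hv'
  have hd : ∀ x ∈ Ioo v v',
      HasDerivAt (fun x => y x + primitive f x - c * reductionR ε (y v) * x)
      (c * reductionR ε (y x) - f x + f x - c * reductionR ε (y v) * 1) x := fun x hx => by
    have hx' : x ∈ Ioo (0 : ℝ) 1 := ⟨hv0.trans hx.1, hx.2.trans_le hv'⟩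
    exact ((hy.hasDerivAt x hx').add (hasDerivAt_primitive h.continuousOn hx')).sub
      ((hasDerivAt_id x).const_mul _)
  have hanti : AntitoneOn (fun x => y x + primitive f x - c * reductionR ε (y v) * x)
      (Icc v v') := by
    refine antitoneOn_of_deriv_nonpos (convex_Icc v v')
      (((hy.continuousOn.add (continuousOn_primitive h.continuousOn)).mono hsub).sub
        (by fun_prop)) ?_ ?_
    · rw [interior_Icc]
      exact fun x hx => (hd x hx).differentiableAt.differentiableWithinAt
    · rw [interior_Icc]
      intro x hx
      rw [(hd x hx).deriv]
      have h1 : y x ≤ y v := hya ⟨hmv, hvv.le.trans hv'⟩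
        ⟨hmv.trans hx.1.le, hx.2.le.trans hv'⟩ hx.1.le
      have h2 := mul_le_mul_of_nonneg_left (reductionR_mono hε
        (hy.pos x ⟨hv0.trans hx.1, hx.2.trans_le hv'⟩).le h1) hc0
      linarith
  have h1 := hanti (left_mem_Icc.2 hvv.le) (right_mem_Icc.2 hvv.le) hvv.le
  dsimp only at h1
  have h2 := mul_sub_le_primitive_sub h.continuousOn (C := f v') hv0.le hvv.le hv' fun r hr =>
    h.strictAntiOn.antitoneOn ⟨hmv.trans hr.1, hr.2.trans hv'⟩ ⟨hmv.trans hvv.le, hv'⟩ hr.2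
  have h3 : y v ≤ y p := hya ⟨h.m_lt.le, h.lt_one.le⟩ ⟨hmv, hvv.le.trans hv'⟩ hpv
  have h4 := h.terminal_p_le hy hy0 hε hc
  have h5 := hy.nonneg (v := v') ⟨(hv0.trans hvv).le, hv'⟩
  linarith

end IsReactionShape

/-- Solutions `y ε` of the first-order reduction at speeds `c ε` that tend to `f p`. -/
structure IsVanishingFamily (f : ℝ → ℝ) (p : ℝ) (c : ℝ → ℝ) (y : ℝ → ℝ → ℝ) : Prop where
  tendsto : Tendsto c (𝓝[>] 0) (𝓝 (f p))
  lt : ∀ ε > 0, f p < c ε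
  isTerminalSolution : ∀ ε > 0, IsTerminalSolution f ε (c ε) (y ε)
  zero : ∀ ε > 0, y ε 0 = 0

namespace IsVanishingFamily

variable {f : ℝ → ℝ} {m p : ℝ} {c : ℝ → ℝ} {y : ℝ → ℝ → ℝ}

lemma eventually_le (H : IsVanishingFamily f p c y) (h : IsReactionShape f m p) {κ a b : ℝ}
    (ha : 0 ≤ a) (hb : b ≤ p) (hκ : 0 < κ) (hle : ∀ s ∈ Icc a b, κ ≤ f p * s - primitive f s)
    {r : ℝ} (hr : r < 1) :
    ∀ᶠ ε in 𝓝[>] (0 : ℝ), ∀ s ∈ Icc a b, r < reductionR ε (y ε s) := by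
  have h1 : ∀ᶠ ε in 𝓝[>] (0 : ℝ), c ε < f p + κ / 2 :=
    H.tendsto.eventually (gt_mem_nhds (by linarith))
  have h2 : Tendsto (fun ε : ℝ => 1 - ε / (κ / 2)) (𝓝[>] 0) (𝓝 1) := by
    have : Continuous fun ε : ℝ => 1 - ε / (κ / 2) := by fun_prop
    simpa using (this.tendsto 0).mono_left nhdsWithin_le_nhds
  filter_upwards [h1, h2.eventually (lt_mem_nhds hr), self_mem_nhdsWithin] with ε hcε hrε hε s hs
  have hε' : (0 : ℝ) < ε := hε
  have h3 := h.le_terminal_of_le (H.isTerminalSolution ε hε) hε' (H.lt ε hε) (ha.trans hs.1)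
    (hs.2.trans hb)
  have h4 : κ / 2 ≤ y ε s := by linarith [hle s hs]
  refine hrε.trans_le (le_trans ?_ (one_sub_div_le_reductionR hε' (by linarith)))
  have : ε / (ε + y ε s) ≤ ε / (κ / 2) := by gcongr; linarith
  linarith

/-- The upper bounds hold for every `ε`: `R < 1` up to `p`, the nullcline together with `c > f p`
beyond. The lower bound comes from the gap below `p`, and from `mul_sub_le_of_ge` with `v'` slightly
to the right of `s` otherwise. -/
lemma tendsto_reductionR (H : IsVanishingFamily f p c y) (h : IsReactionShape f m p) {s : ℝ}
    (hs : s ∈ Ioo (0 : ℝ) 1) :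
    Tendsto (fun ε => reductionR ε (y ε s)) (𝓝[>] 0) (𝓝 (limitSpeed f p s)) := by
  refine tendsto_order.2 ⟨fun r hr => ?_, fun r hr => ?_⟩
  · rcases lt_or_ge s p with hsp | hsp
    · rw [h.limitSpeed_of_le hsp.le] at hr
      refine (H.eventually_le h hs.1.le hsp.le (sub_pos.2 (h.primitive_lt s ⟨hs.1, hsp⟩))
        (fun x hx => ?_) hr).mono fun ε hε => hε s ⟨le_rfl, le_rfl⟩
      rw [le_antisymm hx.2 hx.1]
    · rw [IsReactionShape.limitSpeed_of_ge hsp, lt_div_iff₀ h.f_p_pos] at hr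
      have hcont := h.continuousOn.continuousAt (Icc_mem_nhds hs.1 hs.2)
      obtain ⟨v', ⟨hv', hv1⟩, hsv⟩ := (((hcont.eventually (lt_mem_nhds hr)).and
        (gt_mem_nhds hs.2)).filter_mono nhdsWithin_le_nhds |>.and
          (self_mem_nhdsWithin (s := Ioi s))).exists
      have hsv' : 0 < v' - s := sub_pos.2 hsv
      have hlim : Tendsto (fun ε => (f v' - (c ε - f p) / (v' - s)) / c ε) (𝓝[>] 0)
          (𝓝 ((f v' - (f p - f p) / (v' - s)) / f p)) :=
        (((H.tendsto.sub_const _).div_const _).const_sub _).div H.tendsto h.f_p_pos.ne'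
      have hlt : r < (f v' - (f p - f p) / (v' - s)) / f p := by
        rw [sub_self, zero_div, sub_zero, lt_div_iff₀ h.f_p_pos]
        exact hv'
      filter_upwards [hlim.eventually (lt_mem_nhds hlt), self_mem_nhdsWithin] with ε hrε hε
      refine hrε.trans_le ?_
      have hc := H.lt ε hε
      rw [div_le_iff₀ (h.f_p_pos.trans hc), sub_le_comm, le_div_iff₀ hsv']
      have := h.mul_sub_le_of_ge (H.isTerminalSolution ε hε) (H.zero ε hε) hε hc hsp hsv hv1.le
      linarith
  · filter_upwards [self_mem_nhdsWithin] with ε hε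
    refine lt_of_le_of_lt ?_ hr
    have hc := H.lt ε hε
    have hy := H.isTerminalSolution ε hε
    rcases le_or_gt s p with hsp | hsp
    · rw [h.limitSpeed_of_le hsp]
      exact (reductionR_lt_one hε (hy.pos s hs).le).le
    · rw [IsReactionShape.limitSpeed_of_ge hsp.le, le_div_iff₀ h.f_p_pos]
      have h1 := h.speed_mul_reductionR_le hy hε (h.f_p_pos.trans hc).le (h.m_lt.trans hsp).le hs.2
      have h2 := mul_le_mul_of_nonneg_right hc.le (reductionR_nonneg hε (hy.pos s hs).le)
      linarith

/-- Provides the dominating constant for `1 / R(y)` in the time integral. Up to `m` the gap has a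
positive minimum; beyond `m`, `y` is nonincreasing and one point controls all. -/
lemma exists_eventually_le (H : IsVanishingFamily f p c y) (h : IsReactionShape f m p) {a b : ℝ}
    (ha : 0 < a) (hb : b < 1) :
    ∃ r > 0, ∀ᶠ ε in 𝓝[>] (0 : ℝ), ∀ s ∈ Icc a b, r ≤ reductionR ε (y ε s) := by
  have hleft : ∀ᶠ ε in 𝓝[>] (0 : ℝ), ∀ s ∈ Icc a m, 1 / 2 < reductionR ε (y ε s) := by
    rcases lt_or_ge m a with ham | ham
    · exact Eventually.of_forall fun ε s hs => absurd (hs.1.trans hs.2) ham.not_ge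
    have hcont : ContinuousOn (fun s => f p * s - primitive f s) (Icc a m) :=
      ContinuousOn.sub (by fun_prop) ((continuousOn_primitive h.continuousOn).mono
        (Icc_subset_Icc ha.le (h.m_lt.trans h.lt_one).le))
    obtain ⟨t, ht, hmin⟩ := isCompact_Icc.exists_isMinOn (nonempty_Icc.2 ham) hcont
    exact H.eventually_le h ha.le h.m_lt.le
      (sub_pos.2 (h.primitive_lt t ⟨ha.trans_le ht.1, ht.2.trans_lt h.m_lt⟩))
      (fun s hs => hmin hs) (by norm_num)
  have hb' : max b p ∈ Ioo (0 : ℝ) 1 := ⟨lt_max_of_lt_right h.p_pos, max_lt hb h.lt_one⟩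
  have hpos := h.limitSpeed_pos hb'
  refine ⟨min (1 / 2) (limitSpeed f p (max b p) / 2), by positivity, ?_⟩
  filter_upwards [hleft, (H.tendsto_reductionR h hb').eventually (lt_mem_nhds (half_lt_self hpos)),
    self_mem_nhdsWithin] with ε h1 h2 hε s hs
  have hy := H.isTerminalSolution ε hε
  rcases le_total s m with hsm | hsm
  · exact (min_le_left _ _).trans (h1 s ⟨hs.1, hsm⟩).le
  · refine (min_le_right _ _).trans (h2.le.trans (reductionR_mono hε (hy.pos _ hb').le ?_))
    have hsb : s ≤ max b p := hs.2.trans (le_max_left _ _)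
    exact h.antitoneOn_terminal hy hε (h.f_p_pos.trans (H.lt ε hε)).le
      ⟨hsm, hsb.trans hb'.2.le⟩ ⟨hsm.trans hsb, hb'.2.le⟩ hsb

lemma tendsto_timeMap (H : IsVanishingFamily f p c y) (h : IsReactionShape f m p) {s : ℝ}
    (hs : s ∈ Ioo (0 : ℝ) 1) :
    Tendsto (fun ε => timeMap (fun r => reductionR ε (y ε r)) s) (𝓝[>] 0)
      (𝓝 (timeMap (limitSpeed f p) s)) := by
  have hhalf : (1 / 2 : ℝ) ∈ Ioo (0 : ℝ) 1 := by norm_num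
  have hsub : uIoc (1 / 2) s ⊆ Ioo 0 1 :=
    uIoc_subset_uIcc.trans (ordConnected_Ioo.uIcc_subset hhalf hs)
  obtain ⟨r, hr, hev⟩ := H.exists_eventually_le h (a := min (1 / 2) s) (b := max (1 / 2) s)
    (lt_min hhalf.1 hs.1) (max_lt hhalf.2 hs.2)
  refine intervalIntegral.tendsto_integral_filter_of_dominated_convergence (fun _ => r⁻¹) ?_ ?_
    intervalIntegrable_const (Eventually.of_forall fun x hx => ?_)
  · filter_upwards [self_mem_nhdsWithin] with ε hε
    have hy := H.isTerminalSolution ε hε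
    refine ContinuousOn.aestronglyMeasurable ?_ measurableSet_uIoc
    refine ContinuousOn.inv₀ ((continuousOn_reductionR hε).comp (hy.continuousOn.mono
      (hsub.trans Ioo_subset_Icc_self)) fun x hx => (hy.pos x (hsub hx)).le) fun x hx =>
      (reductionR_pos hε (hy.pos x (hsub hx))).ne'
  · filter_upwards [hev, self_mem_nhdsWithin] with ε hle hε
    refine Eventually.of_forall fun x hx => ?_
    have h1 := hle x (uIoc_subset_uIcc hx)
    rw [Real.norm_of_nonneg (inv_nonneg.2 (hr.le.trans h1))]
    exact inv_anti₀ hr h1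
  · exact (H.tendsto_reductionR h (hsub hx)).inv₀ (h.limitSpeed_pos (hsub hx)).ne'

end IsVanishingFamily

/-! ### From pointwise to uniform convergence. -/

/-- Pointwise convergence of distribution functions to a continuous one is uniform. -/
lemma tendstoUniformly_of_monotone {ι : Type*} {l : Filter ι} {v : ι → ℝ → ℝ} {V : ℝ → ℝ}
    (hv : ∀ᶠ i in l, Monotone (v i) ∧ ∀ z, v i z ∈ Icc (0 : ℝ) 1) (hc : Continuous V)
    (hm : Monotone V) (hbot : Tendsto V atBot (𝓝 0)) (htop : Tendsto V atTop (𝓝 1))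
    (hlim : ∀ z, Tendsto (fun i => v i z) l (𝓝 (V z))) : TendstoUniformly v V l := by
  refine Metric.tendstoUniformly_iff.2 fun η hη => ?_
  have hV : ∀ z, V z ∈ Icc (0 : ℝ) 1 := fun z => ⟨hm.le_of_tendsto hbot z, hm.ge_of_tendsto htop z⟩
  obtain ⟨N, hN⟩ := exists_nat_gt (2 / η)
  have hN0 : (0 : ℝ) < N := (by positivity : 0 < 2 / η).trans hN
  have hNη : 2 / (N : ℝ) < η := by rwa [div_lt_comm₀ hN0 hη]
  have hlev : ∀ i : ℕ, ∃ z, 0 < i → i < N → V z = i / N := fun i => by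
    by_cases hi : 0 < i ∧ i < N
    · have h0 : (0 : ℝ) < i / N := div_pos (by exact_mod_cast hi.1) hN0
      have h1 : (i / N : ℝ) < 1 := (div_lt_one hN0).2 (by exact_mod_cast hi.2)
      obtain ⟨z, hz⟩ := mem_range_of_exists_le_of_exists_ge hc
        ((hbot.eventually (gt_mem_nhds h0)).exists.imp fun _ h => h.le)
        ((htop.eventually (lt_mem_nhds h1)).exists.imp fun _ h => h.le)
      exact ⟨z, fun _ _ => hz⟩
    · exact ⟨0, fun h h' => (hi ⟨h, h'⟩).elim⟩
  choose x hx using hlev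
  have hev : ∀ᶠ i in l, ∀ j ∈ Finset.range N, dist (v i (x j)) (V (x j)) < 1 / N :=
    (Filter.eventually_all_finset _).2 fun j _ =>
      (hlim (x j)).eventually (Metric.ball_mem_nhds _ (by positivity))
  filter_upwards [hv, hev] with i hi hclose z
  have h2N : 2 / (N : ℝ) = 1 / N + 1 / N := by ring
  have h1N : 0 < 1 / (N : ℝ) := by positivity
  have hclose' : ∀ j : ℕ, 0 < j → j < N →
      (j : ℝ) / N - 1 / N < v i (x j) ∧ v i (x j) < j / N + 1 / N := fun j h0 h1 => by
    have := hclose j (Finset.mem_range.2 h1)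
    rw [hx j h0 h1, Real.dist_eq, abs_lt] at this
    constructor <;> linarith
  have hvz := hi.2 z
  have hVz := hV z
  have hNV : 0 ≤ N * V z := mul_nonneg hN0.le hVz.1
  rw [Real.dist_eq, abs_lt]
  constructor
  -- `j / N` is the first level strictly above `V z`; if `j ≥ N`, the bound `v i z ≤ 1` suffices.
  · set j := ⌊(N : ℝ) * V z⌋₊ + 1 with hj
    have h1 : (N : ℝ) * V z < j := by
      simp only [hj]; push_cast; exact Nat.lt_floor_add_one _
    have h2 : (j : ℝ) ≤ N * V z + 1 := by
      simp only [hj]; push_cast; linarith [Nat.floor_le hNV]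
    have h3 : (j : ℝ) / N ≤ V z + 1 / N := by
      rw [div_le_iff₀ hN0, add_mul, div_mul_cancel₀ _ hN0.ne']; linarith
    rcases lt_or_ge j N with hjN | hjN
    · have h4 : V z < V (x j) := by
        rw [hx j (Nat.succ_pos _) hjN, lt_div_iff₀ hN0]; linarith
      have h5 := hi.1 (hm.reflect_lt h4).le
      linarith [(hclose' j (Nat.succ_pos _) hjN).2]
    · have h4 : 1 ≤ (j : ℝ) / N := (one_le_div hN0).2 (by exact_mod_cast hjN)
      linarith [hvz.2]
  -- `j / N` is the last level strictly below `V z`. When `j = 0`, also through truncated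
  -- subtraction, `V z ≤ 1 / N` and `0 ≤ v i z` suffices.
  · set j := ⌈(N : ℝ) * V z⌉₊ - 1 with hj
    have h2 : (N : ℝ) * V z ≤ j + 1 := by
      have h3 : ⌈(N : ℝ) * V z⌉₊ ≤ j + 1 := by omega
      exact (Nat.le_ceil _).trans (by exact_mod_cast h3)
    have h3 : V z ≤ j / N + 1 / N := by
      rw [← add_div, le_div_iff₀ hN0]; linarith
    rcases Nat.eq_zero_or_pos j with h0 | h0
    · rw [h0, Nat.cast_zero, zero_div] at h3
      linarith [hvz.1]
    · have h1 : (j : ℝ) < N * V z := Nat.lt_ceil.1 (by omega)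
      have hjN : j < N := by
        have : (j : ℝ) < N := h1.trans_le (mul_le_of_le_one_right hN0.le hVz.2)
        exact_mod_cast this
      have h4 : V (x j) < V z := by
        rw [hx j h0 hjN, div_lt_iff₀ hN0]; linarith
      have h5 := hi.1 (hm.reflect_lt h4).le
      linarith [(hclose' j h0 hjN).1]

/-! ### The inviscid profile. -/

section inviscid

variable {f V : ℝ → ℝ} {m p z₀ v₀ : ℝ}

lemma IsReactionShape.isSpeedField (h : IsReactionShape f m p) :
    IsSpeedField fun s => f s / f p := by
  obtain ⟨k, hk0, hk⟩ := h.linear_control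
  have hp := h.f_p_pos
  refine ⟨(h.continuousOn.mono Ioo_subset_Icc_self).div_const _, fun s hs => div_pos (h.pos s hs) hp,
    k / f p, by positivity, fun s hs => ?_⟩
  obtain ⟨h1, h2⟩ := hk s (Ioo_subset_Icc_self hs)
  rw [div_mul_eq_mul_div, div_mul_eq_mul_div]
  exact ⟨div_le_div_of_nonneg_right (le_of_abs_le h1) hp.le,
    div_le_div_of_nonneg_right (le_of_abs_le h2) hp.le⟩

lemma IsInviscidSolution.hasDerivAt (h : IsReactionShape f m p)
    (hV : IsInviscidSolution f (f p) z₀ v₀ V) (z : ℝ) : HasDerivAt V (f (V z) / f p) z := by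
  rw [← hV.equation z, mul_div_cancel_left₀ _ h.f_p_pos.ne']
  exact (hV.differentiable z).hasDerivAt

/-- Solutions are a priori allowed to touch `1`. The linear control at `1` excludes this to the
right of `z₀`, and monotonicity to the left; only then does the time map apply. -/
lemma IsInviscidSolution.lt_one (h : IsReactionShape f m p)
    (hV : IsInviscidSolution f (f p) z₀ v₀ V) (hv₀ : v₀ < 1) (z : ℝ) : V z < 1 := by
  obtain ⟨k, hk0, hk⟩ := h.linear_control
  have hp := h.f_p_pos
  have hmem : ∀ x, V x ∈ Icc (0 : ℝ) 1 := fun x => ⟨(hV.pos x).le, hV.le_one x⟩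
  have hf1 : f 1 = 0 := by
    have := (hk 1 (by simp)).2
    rwa [sub_self, mul_zero, abs_nonpos_iff] at this
  rcases le_total z₀ z with hz | hz
  · have := pos_of_neg_mul_le_hasDerivAt (C := k / f p) (a := z₀) (z := z)
      (fun x => (hV.hasDerivAt h x).const_sub 1) (fun x => ?_)
      (by rw [hV.initial]; linarith) hz
    · linarith
    · have h1 := le_of_abs_le (hk _ (hmem x)).2
      rw [neg_mul, neg_le_neg_iff, div_mul_eq_mul_div]
      exact div_le_div_of_nonneg_right h1 hp.le
  · have hm : Monotone V := monotone_of_hasDerivAt_nonneg (hV.hasDerivAt h) fun x => by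
      refine div_nonneg ?_ hp.le
      rcases (hmem x).2.eq_or_lt with h1 | h1
      · rw [h1, hf1]
      · exact (h.pos _ ⟨hV.pos x, h1⟩).le
    exact (hm hz).trans_lt (hV.initial ▸ hv₀)

/-- The profile `𝒱_I(·; z₀, v₀)` is a translate of the flow. -/
lemma IsReactionShape.isProfileI (h : IsReactionShape f m p) (hv₀ : v₀ ∈ Ioo (0 : ℝ) 1) (z₀ : ℝ) :
    IsProfileI f (f p) z₀ v₀
      fun z => h.isSpeedField.flow (z - z₀ + timeMap (fun s => f s / f p) v₀) := by
  have hd : ∀ z, HasDerivAt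
      (fun z => h.isSpeedField.flow (z - z₀ + timeMap (fun s => f s / f p) v₀))
      (f (h.isSpeedField.flow (z - z₀ + timeMap (fun s => f s / f p) v₀)) / f p) z := fun z => by
    have h1 : HasDerivAt (fun z => z - z₀ + timeMap (fun s => f s / f p) v₀) 1 z :=
      ((hasDerivAt_id z).sub_const z₀).add_const _
    simpa [Function.comp_def] using (h.isSpeedField.hasDerivAt_flow _).comp z h1
  refine ⟨⟨fun z => (h.isSpeedField.flow_mem _).1, fun z => (h.isSpeedField.flow_mem _).2.le,
    fun z => (hd z).differentiableAt, fun z => ?_, ?_⟩, fun W hW => funext fun z => ?_⟩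
  · rw [(hd z).deriv, mul_div_cancel₀ _ h.f_p_pos.ne']
  · rw [sub_self, zero_add, h.isSpeedField.flow_timeMap hv₀]
  · have := h.isSpeedField.eq_flow (fun z => ⟨hW.pos z, hW.lt_one h hv₀.2 z⟩)
      (hW.hasDerivAt h) z₀ z
    rwa [hW.initial] at this

end inviscid

/-! ### The glued profile and convergence to it. -/

/-- The profile made of a linear piece up to the value `p` and of an inviscid piece. -/
lemma glue_profileL_eq {V : ℝ → ℝ} {p z₀ : ℝ} (hp : p < 1) :
    glue z₀ (profileL z₀ p) V = fun z => if z ≤ z₀ then max 0 (z - z₀ + p) else V z := by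
  funext z
  unfold glue profileL
  split_ifs with h1 h2 h3
  · rw [max_eq_left]; linarith
  · rw [max_eq_right]; linarith
  · linarith
  · rfl

section gluing

variable {f V : ℝ → ℝ} {m p z₀ : ℝ}

lemma continuous_glue (hp : p ∈ Ioo (0 : ℝ) 1) (hVc : Continuous V) (hV0 : V z₀ = p) :
    Continuous (glue z₀ (profileL z₀ p) V) := by
  rw [glue_profileL_eq hp.2]
  refine Continuous.if_le (by fun_prop) hVc continuous_id continuous_const ?_
  rintro z rfl
  rw [sub_self, zero_add, max_eq_right hp.1.le, hV0]

lemma monotone_glue (hp : p ∈ Ioo (0 : ℝ) 1) (hVm : Monotone V) (hV0 : V z₀ = p) :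
    Monotone (glue z₀ (profileL z₀ p) V) := by
  rw [glue_profileL_eq hp.2]
  intro a b hab
  dsimp only
  split_ifs with h1 h2 h2
  · gcongr
  · refine max_le ?_ ?_
    · linarith [hVm (not_le.1 h2).le, hp.1]
    · linarith [hVm (not_le.1 h2).le]
  · exact absurd (hab.trans h2) h1
  · exact hVm hab

lemma glue_mem (hp : p ∈ Ioo (0 : ℝ) 1) (hV : ∀ z, V z ∈ Ioo (0 : ℝ) 1) {z : ℝ}
    (hz : z₀ - p < z) : glue z₀ (profileL z₀ p) V z ∈ Ioo (0 : ℝ) 1 := by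
  rw [glue_profileL_eq hp.2]
  dsimp only
  split_ifs with h
  · rw [max_eq_right (by linarith)]
    exact ⟨by linarith, by linarith [hp.2]⟩
  · exact hV z

/-- Both pieces follow the speed `limitSpeed f p`, which is `1` up to the value `p` and `f / f p`
beyond. Points `z ≤ z₀ - p` are left out, since the slope jumps at the corner `z₀ - p`. -/
lemma hasDerivAt_glue (h : IsReactionShape f m p) (hVm : Monotone V) (hV0 : V z₀ = p)
    (hVd : ∀ z, HasDerivAt V (f (V z) / f p) z) {z : ℝ} (hz : z₀ - p < z) :
    HasDerivAt (glue z₀ (profileL z₀ p) V)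
      (limitSpeed f p (glue z₀ (profileL z₀ p) V z)) z := by
  have hlin : ∀ x, z₀ - p < x → x ≤ z₀ → glue z₀ (profileL z₀ p) V x = x - z₀ + p :=
    fun x h1 h2 => by
      rw [glue_profileL_eq h.lt_one]
      simp only [h2, if_true]
      rw [max_eq_right (by linarith)]
  have hright : ∀ x, z₀ ≤ x → glue z₀ (profileL z₀ p) V x = V x := fun x h1 => by
    rcases h1.eq_or_lt with rfl | h1
    · rw [hlin z₀ (by linarith [h.p_pos]) le_rfl, hV0, sub_self, zero_add]
    · rw [glue, if_neg h1.not_ge]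
  have hd : HasDerivAt (fun x => x - z₀ + p) 1 z := ((hasDerivAt_id z).sub_const z₀).add_const p
  rcases lt_trichotomy z z₀ with hlt | rfl | hgt
  · rw [hlin z hz hlt.le, h.limitSpeed_of_le (by linarith)]
    refine hd.congr_of_eventuallyEq ?_
    filter_upwards [Ioo_mem_nhds hz hlt] with x hx
    exact hlin x hx.1 hx.2.le
  · have hval : glue z (profileL z p) V z = p := by rw [hright z le_rfl, hV0]
    rw [hval, h.limitSpeed_of_le le_rfl]
    have h1 : HasDerivWithinAt (glue z (profileL z p) V) 1 (Iic z) z := by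
      refine hd.hasDerivWithinAt.congr_of_eventuallyEq ?_ (hlin z hz le_rfl)
      filter_upwards [mem_nhdsWithin_of_mem_nhds (Ioi_mem_nhds hz), self_mem_nhdsWithin] with x h1 h2
      exact hlin x h1 h2
    have h2 : HasDerivWithinAt (glue z (profileL z p) V) 1 (Ici z) z := by
      have := (hVd z).hasDerivWithinAt (s := Ici z)
      rw [hV0, div_self h.f_p_pos.ne'] at this
      exact this.congr (fun x hx => hright x hx) (hright z le_rfl)
    have := h1.union h2
    rwa [Iic_union_Ici, hasDerivWithinAt_univ] at this
  · rw [hright z hgt.le, IsReactionShape.limitSpeed_of_ge (hV0 ▸ hVm hgt.le)]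
    refine (hVd z).congr_of_eventuallyEq ?_
    filter_upwards [Ioi_mem_nhds hgt] with x hx
    exact hright x (le_of_lt hx)

/-- Convergence of the critical profiles to the glued profile. -/
lemma convergesToGluing {v : ℝ → ℝ → ℝ} {c : ℝ → ℝ} {y : ℝ → ℝ → ℝ}
    (h : IsReactionShape f m p) (H : IsVanishingFamily f p c y)
    (hv : ∀ ε > 0, ∃ hG : IsSpeedField fun s => reductionR ε (y ε s), v ε = hG.flow)
    (hV : ∀ z, V z ∈ Ioo (0 : ℝ) 1) (hVm : Monotone V) (hVtop : Tendsto V atTop (𝓝 1))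
    (hVd : ∀ z, HasDerivAt V (f (V z) / f p) z) (hV0 : V z₀ = p)
    (h0 : glue z₀ (profileL z₀ p) V 0 = 1 / 2) :
    ConvergesToGluing v (glue z₀ (profileL z₀ p) V) z₀ := by
  set g := glue z₀ (profileL z₀ p) V with hg
  have hp := h.p_mem
  have hVc : Continuous V := continuous_iff_continuousAt.2 fun z => (hVd z).continuousAt
  have hgc : Continuous g := continuous_glue hp hVc hV0
  have hgm : Monotone g := monotone_glue hp hVm hV0
  have hgd : ∀ z, z₀ - p < z → HasDerivAt g (limitSpeed f p (g z)) z := fun z hz =>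
    hasDerivAt_glue h hVm hV0 hVd hz
  have hg0 : ∀ z ≤ z₀ - p, g z = 0 := fun z hz => by
    rw [hg, glue_profileL_eq h.lt_one]
    simp only [show z ≤ z₀ by linarith [hp.1], if_true]
    exact max_eq_left (by linarith)
  have hgpos : ∀ z, 0 < g z → z₀ - p < z := fun z hz => by
    by_contra! hle
    exact hz.ne' (hg0 z hle)
  have hgmem : ∀ z, z₀ - p < z → g z ∈ Ioo (0 : ℝ) 1 := fun z hz => glue_mem hp hV hz
  have hbot : Tendsto g atBot (𝓝 0) := tendsto_const_nhds.congr' (by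
    filter_upwards [Iic_mem_atBot (z₀ - p)] with z hz
    exact (hg0 z hz).symm)
  have htop : Tendsto g atTop (𝓝 1) := hVtop.congr' (by
    filter_upwards [Ioi_mem_atTop z₀] with z hz
    rw [hg, glue, if_neg (not_le.2 hz)])
  -- Where positive, `g` inverts the limiting time map; `g 0 = 1 / 2` fixes the translation.
  have htime : ∀ z, z₀ - p < z → timeMap (limitSpeed f p) (g z) = z := fun z hz => by
    have := timeMap_sub_eq h.continuousOn_limitSpeed (fun s hs => h.limitSpeed_pos hs) isOpen_Ioi
      (convex_Ioi (z₀ - p)) hgmem hgd hz (hgpos 0 (by rw [h0]; norm_num))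
    rwa [h0, timeMap_half, sub_zero, sub_zero] at this
  have hlev : ∀ s ∈ Ioo (0 : ℝ) 1, g (timeMap (limitSpeed f p) s) = s := fun s hs => by
    obtain ⟨z, rfl⟩ := mem_range_of_exists_le_of_exists_ge hgc
      ((hbot.eventually (gt_mem_nhds hs.1)).exists.imp fun _ h => h.le)
      ((htop.eventually (lt_mem_nhds hs.2)).exists.imp fun _ h => h.le)
    rw [htime z (hgpos z hs.1)]
  have hvmem : ∀ ε > 0, Monotone (v ε) ∧ ∀ z, v ε z ∈ Ioo (0 : ℝ) 1 := fun ε hε => by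
    obtain ⟨hG, hGv⟩ := hv ε hε
    rw [hGv]
    exact ⟨hG.strictMono_flow.monotone, hG.flow_mem⟩
  refine ⟨tendstoUniformly_of_monotone ?_ hgc hgm hbot htop fun z => ?_, ?_, ?_⟩
  · filter_upwards [self_mem_nhdsWithin] with ε hε
    exact ⟨(hvmem ε hε).1, fun z => Ioo_subset_Icc_self ((hvmem ε hε).2 z)⟩
  -- Convergence of inverse functions: `s < v ε z` says that the time map of `ε` at `s` is below
  -- `z`, and these time maps converge at each `s`.
  · refine tendsto_order.2 ⟨fun s hs => ?_, fun s hs => ?_⟩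
    · rcases le_or_gt s 0 with hs0 | hs0
      · filter_upwards [self_mem_nhdsWithin] with ε hε
        exact hs0.trans_lt ((hvmem ε hε).2 z).1
      have hsI : s ∈ Ioo (0 : ℝ) 1 := ⟨hs0, hs.trans (hgmem z (hgpos z (hs0.trans hs))).2⟩
      have hlt : timeMap (limitSpeed f p) s < z := hgm.reflect_lt (by rwa [hlev s hsI])
      filter_upwards [(H.tendsto_timeMap h hsI).eventually (gt_mem_nhds hlt),
        self_mem_nhdsWithin] with ε hεz hε
      obtain ⟨hG, hGv⟩ := hv ε hε
      rw [hGv]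
      exact (hG.lt_flow_iff hsI).2 hεz
    · rcases le_or_gt 1 s with hs1 | hs1
      · filter_upwards [self_mem_nhdsWithin] with ε hε
        exact ((hvmem ε hε).2 z).2.trans_le hs1
      have hsI : s ∈ Ioo (0 : ℝ) 1 := ⟨(hgm.le_of_tendsto hbot z).trans_lt hs, hs1⟩
      have hlt : z < timeMap (limitSpeed f p) s := hgm.reflect_lt (by rwa [hlev s hsI])
      filter_upwards [(H.tendsto_timeMap h hsI).eventually (lt_mem_nhds hlt),
        self_mem_nhdsWithin] with ε hεz hε
      obtain ⟨hG, hGv⟩ := hv ε hε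
      rw [hGv]
      exact (hG.flow_lt_iff hsI).2 hεz
  · have : ContDiffOn ℝ 1 g (Ioi (z₀ - p)) := by
      rw [show (1 : WithTop ℕ∞) = 0 + 1 from rfl, contDiffOn_succ_iff_deriv_of_isOpen isOpen_Ioi]
      refine ⟨fun z hz => (hgd z hz).differentiableAt.differentiableWithinAt, by simp, ?_⟩
      rw [contDiffOn_zero]
      exact (h.continuousOn_limitSpeed.comp hgc.continuousOn hgmem).congr fun z hz => (hgd z hz).deriv
    exact this.contDiffAt (Ioi_mem_nhds (by linarith [hp.1]))
  · have hz : z₀ - p < z₀ := by linarith [hp.1]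
    have hgz : g z₀ = p := by
      rw [hg, glue_profileL_eq h.lt_one]
      simp [hp.1.le]
    rw [(hgd z₀ hz).deriv, hgz, h.limitSpeed_of_le le_rfl]

end gluing

/-! ### Assembly of the theorem. -/

/-- Used to recentre `profileL 0 normV0` at the gluing point, where its value is `p`. -/
lemma profileL_eq_of_sub_eq {z₀ v₀ z₁ v₁ : ℝ} (h : z₀ - v₀ = z₁ - v₁) :
    profileL z₀ v₀ = profileL z₁ v₁ := by
  funext z
  have h1 : 1 + z₀ - v₀ = 1 + z₁ - v₁ := by linarith
  have h2 : z - z₀ + v₀ = z - z₁ + v₁ := by linarith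
  rw [profileL, profileL, h, h1, h2]

/-- Critical speed and critical profile. -/
lemma IsReactionShape.exists_critical {f : ℝ → ℝ} {m p ε k : ℝ} (h : IsReactionShape f m p)
    (hε : 0 < ε) (hk0 : 0 < k)
    (hk : ∀ s ∈ Icc (0 : ℝ) 1, |f s| ≤ k * s ∧ |f s| ≤ k * (1 - s)) :
    ∃ (c : ℝ) (v y : ℝ → ℝ), IsCriticalSpeed f ε c ∧ IsNormalizedProfile f ε c v ∧
      (∀ w, IsNormalizedProfile f ε c w → w = v) ∧ f p < c ∧ c ≤ f p + √(4 * k * ε) ∧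
      IsTerminalSolution f ε c y ∧ y 0 = 0 ∧
      ∃ hG : IsSpeedField fun s => reductionR ε (y s), v = hG.flow := by
  obtain ⟨c, hc, hlt, hle⟩ := h.exists_isCriticalSpeed hε hk0 fun s hs => le_of_abs_le (hk s hs).1
  have hadm : IsAdmissibleSpeed f ε c := by
    have : c ∈ {c' : ℝ | IsAdmissibleSpeed f ε c'} := by rw [hc]; exact self_mem_Ici
    exact this
  obtain ⟨hc0, y, hy, hy0⟩ := (isAdmissibleSpeed_iff h.pos hε).1 hadm
  have hG := hy.isSpeedField hε hc0 hy0 h.pos hk0 fun s hs => (hk s hs).2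
  refine ⟨c, hG.flow, y, hc, ⟨hy.isHeteroclinic_flow hε h.continuousOn hG, hG.flow_zero⟩,
    fun w hw => funext fun z => ?_, hlt, hle, hy, hy0, hG, rfl⟩
  have hw0 : w 0 = 1 / 2 := hw.2
  have hnn : ∀ s ∈ Icc (0 : ℝ) 1, 0 ≤ f s := fun s hs => by
    have hcl : closure (Ioo (0 : ℝ) 1) = Icc 0 1 := closure_Ioo zero_ne_one
    exact ContinuousWithinAt.closure_le (s := Ioo (0 : ℝ) 1) (f := fun _ => (0 : ℝ)) (by rwa [hcl])
      continuousWithinAt_const ((h.continuousOn s hs).mono Ioo_subset_Icc_self)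
      fun x hx => (h.pos x hx).le
  have hmem : ∀ x, w x ∈ Ioo (0 : ℝ) 1 := fun x =>
    ⟨hw.1.pos hε hc0 (by rw [hw0]; norm_num) hnn x,
      hw.1.lt_one hε hc0 (by rw [hw0]; norm_num) hk0 (fun s hs => (hk s hs).2) x⟩
  -- Any normalized profile solves the same autonomous equation inside `(0, 1)`, so it is a
  -- translate of the flow, and its value at `0` makes the translation trivial.
  have := hG.eq_flow hmem (hw.1.hasDerivAt_reductionR hy hε hc0 hmem) 0 z
  rwa [hw0, timeMap_half, sub_zero, add_zero] at this

theorem mainTheorem1 (f : ℝ → ℝ) (hH : ConditionH f) (hA : IsTypeA f) (hF : ConditionF f) :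
    ∃ (cstar : ℝ → ℝ) (v : ℝ → ℝ → ℝ),
      -- critical speeds and critical profiles, for every `ε > 0`
      (∀ ε : ℝ, 0 < ε →
        IsCriticalSpeed f ε (cstar ε) ∧
        IsNormalizedProfile f ε (cstar ε) (v ε) ∧
        ∀ w : ℝ → ℝ, IsNormalizedProfile f ε (cstar ε) w → w = v ε) ∧
      ∃ vplus ∈ Ioo (0 : ℝ) 1,
        IsGreatest {u : ℝ | u ∈ Icc (0 : ℝ) 1 ∧ primitive f u = u * f u} vplus ∧
        Tendsto cstar (𝓝[>] (0 : ℝ)) (𝓝 (f vplus)) ∧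
        (normV0 ≤ vplus →
          ∃ V : ℝ → ℝ, IsProfileI f (f vplus) (vplus - normV0) vplus V ∧
            ConvergesToGluing v
              (glue (vplus - normV0) (profileL 0 normV0) V) (vplus - normV0)) ∧
        (vplus < normV0 →
          ∃ V : ℝ → ℝ, IsProfileI f (f vplus) 0 normV0 V ∧
            ∃ zplus : ℝ, zplus < 0 ∧ V zplus = vplus ∧ (∀ z : ℝ, V z = vplus → z = zplus) ∧
              ConvergesToGluing v
                (glue zplus (profileL zplus vplus) V) zplus) := by
  obtain ⟨m, p, h⟩ := exists_isReactionShape hH hA hF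
  obtain ⟨k, hk0, hk⟩ := h.linear_control
  have hex : ∀ ε : ℝ, ∃ (c : ℝ) (v y : ℝ → ℝ), 0 < ε → IsCriticalSpeed f ε c ∧
      IsNormalizedProfile f ε c v ∧ (∀ w, IsNormalizedProfile f ε c w → w = v) ∧ f p < c ∧
      c ≤ f p + √(4 * k * ε) ∧ IsTerminalSolution f ε c y ∧ y 0 = 0 ∧
      ∃ hG : IsSpeedField fun s => reductionR ε (y s), v = hG.flow := fun ε => by
    by_cases hε : 0 < ε
    · obtain ⟨c, v, y, hc⟩ := h.exists_critical hε hk0 hk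
      exact ⟨c, v, y, fun _ => hc⟩
    · exact ⟨0, 0, 0, fun h => (hε h).elim⟩
  choose c v y hex using hex
  have hlim : Tendsto c (𝓝[>] (0 : ℝ)) (𝓝 (f p)) := by
    have hcont : Continuous fun ε => f p + √(4 * k * ε) := by fun_prop
    have hup : Tendsto (fun ε => f p + √(4 * k * ε)) (𝓝[>] 0) (𝓝 (f p)) := by
      simpa using (hcont.tendsto 0).mono_left nhdsWithin_le_nhds
    refine tendsto_of_tendsto_of_tendsto_of_le_of_le' tendsto_const_nhds hup ?_ ?_
    all_goals
      filter_upwards [self_mem_nhdsWithin] with ε hε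
      obtain ⟨-, -, -, h1, h2, -⟩ := hex ε hε
    · exact h1.le
    · exact h2
  have H : IsVanishingFamily f p c y := by
    refine ⟨hlim, fun ε hε => ?_, fun ε hε => ?_, fun ε hε => ?_⟩
    all_goals obtain ⟨-, -, -, h1, -, h2, h3, -⟩ := hex ε hε
    · exact h1
    · exact h2
    · exact h3
  have hflow : ∀ ε > 0, ∃ hG : IsSpeedField fun s => reductionR ε (y ε s), v ε = hG.flow :=
    fun ε hε => by
      obtain ⟨-, -, -, -, -, -, -, h1⟩ := hex ε hε
      exact h1
  have hp := h.p_mem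
  set T := timeMap (fun s => f s / f p) with hT
  refine ⟨c, v, fun ε hε => ?_, p, hp, ⟨⟨Ioo_subset_Icc_self hp, ?_⟩, fun u hu => ?_⟩, hlim,
    fun hle => ?_, fun hlt => ?_⟩
  · obtain ⟨h1, h2, h3, -⟩ := hex ε hε
    exact ⟨h1, h2, h3⟩
  · rw [h.primitive_eq, mul_comm]
  · exact h.root_le u hu.1 hu.2
  · have hprof := h.isProfileI hp (p - normV0)
    refine ⟨_, hprof, ?_⟩
    rw [profileL_eq_of_sub_eq (show 0 - normV0 = p - normV0 - p by ring)]
    refine convergesToGluing h H hflow (fun z => h.isSpeedField.flow_mem _) ?_ ?_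
      (hprof.1.hasDerivAt h) hprof.1.initial ?_
    · exact h.isSpeedField.strictMono_flow.monotone.comp fun a b hab => by linarith
    · exact h.isSpeedField.tendsto_flow_atTop.comp (tendsto_atTop_add_const_right _ _
        (tendsto_atTop_add_const_right _ _ tendsto_id))
    · rw [glue_profileL_eq h.lt_one]
      dsimp only
      rw [if_pos (sub_nonneg.2 hle), normV0, max_eq_right] <;> linarith
  · have hhalf : normV0 ∈ Ioo (0 : ℝ) 1 := by norm_num [normV0]
    have hprof := h.isProfileI hhalf 0
    have hmono : StrictMono fun z => h.isSpeedField.flow (z - 0 + T normV0) :=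
      h.isSpeedField.strictMono_flow.comp fun a b hab => by linarith
    -- The gluing point is the inviscid travel time from `1 / 2` back to `p`, negative because `p <
    -- 1 / 2`.
    have hVp : h.isSpeedField.flow (T p - T normV0 - 0 + T normV0) = p := by
      rw [sub_zero, sub_add_cancel, h.isSpeedField.flow_timeMap hp]
    have hneg : T p - T normV0 < 0 := by
      have := strictMonoOn_timeMap h.isSpeedField.continuousOn h.isSpeedField.pos hp hhalf hlt
      linarith
    refine ⟨_, hprof, T p - T normV0, hneg, hVp, fun z hz => hmono.injective (hz.trans hVp.symm), ?_⟩
    refine convergesToGluing h H hflow (fun z => h.isSpeedField.flow_mem _) hmono.monotone ?_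
      (hprof.1.hasDerivAt h) hVp ?_
    · exact h.isSpeedField.tendsto_flow_atTop.comp (tendsto_atTop_add_const_right _ _
        (tendsto_atTop_add_const_right _ _ tendsto_id))
    · rw [glue, if_neg (not_le.2 hneg)]
      exact hprof.1.initial
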